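/- Let $n\ge 0$ be an integer and let $\Omega\subset\mathbb{R}^{n+1}$ be a bounded open set whose boundary $M=\partial\Omega$ is a generalised hypersurface, i.e. for some $\kappa\in[0,1)$ one has $\mathcal{H}^{n+\kappa}(M)<\infty$ and there are $\delta,\theta>0$ with $\mathcal{H}^{n+\kappa}(M\cap B(p,\gamma))\ge\theta\,\gamma^{n+\kappa}$ for all $p\in M$ and $\gamma\in(0,\delta]$. Let $d(x,M)$ be the signed distance to $M$, equal to $\operatorname{dist}(x,M)$ for $x\in\Omega$ and to $-\operatorname{dist}(x,M)$ for $x\notin\Omega$. Let $\varepsilon>0$, let $f(s)=2s(s^2-1)$, and let $u$ be a solution of the Allen–Cahn equation $$\partial_t u=\Delta u-\frac{1}{\varepsilon^2}f(u)\quad\text{on }\mathbb{R}^{n+1}\times(0,\infty),\qquad u(\cdot,0)=2\chi-1,$$ where $\chi$ is the indicator function of the compact region $\overline{\Omega}$ bounded by $M$. Here a solution is a function that lies in $L^\infty(\mathbb{R}^{n+1}\times[0,T])$ for every $T>0$, is continuous from $[0,\infty)$ to $\mathcal{D}'(\mathbb{R}^{n+1})$, satisfies the equation in the sense of distributions on $\mathbb{R}^{n+1}\times(0,\infty)$,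 and attains the initial value; $u$ denotes its representative that is continuous on $\mathbb{R}^{n+1}\times(0,\infty)$. Then for all $x\in\mathbb{R}^{n+1}$ and all $t>0$: 1. if $d(x,M)\ge 5\sqrt{n+1}\,\sqrt{t}$, then $u(x,t)\ge\tanh\left(\dfrac{d(x,M)}{\sqrt{t}}-5\sqrt{n+1}\right)$; 2. if $d(x,M)\le -5\sqrt{n+1}\,\sqrt{t}$, then $u(x,t)\le\tanh\left(\dfrac{d(x,M)}{\sqrt{t}}+5\sqrt{n+1}\right)$. -/

import Mathlib

open MeasureTheory Set
open scoped ContDiff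

noncomputable section

namespace AllenCahn

/-- `Ω ⊆ ℝⁿ⁺¹` is a bounded open set whose boundary `M = ∂Ω` is a generalised hypersurface: for some
`κ ∈ [0, 1)` the set `M` has finite `(n + κ)`-dimensional Hausdorff measure and a lower
`(n + κ)`-density bound at all scales in `(0, δ]`.
(The normalisation of the Hausdorff measure does not matter here.) -/
structure BoundsGeneralisedHypersurface (n : ℕ)
    (Ω : Set (EuclideanSpace ℝ (Fin (n + 1)))) : Prop where
  isOpen : IsOpen Ω
  isBounded : Bornology.IsBounded Ω
  exists_dim : ∃ κ : ℝ, 0 ≤ κ ∧ κ < 1 ∧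
    Measure.hausdorffMeasure ((n : ℝ) + κ) (frontier Ω) < ⊤ ∧
    ∃ δ θ : ℝ, 0 < δ ∧ 0 < θ ∧ ∀ p ∈ frontier Ω, ∀ γ : ℝ, 0 < γ → γ ≤ δ →
      ENNReal.ofReal (θ * γ ^ ((n : ℝ) + κ)) ≤
        Measure.hausdorffMeasure ((n : ℝ) + κ) (frontier Ω ∩ Metric.ball p γ)

open Classical in
/-- Signed distance to the boundary `M = ∂Ω`, positive in the interior region `Ω`. -/
def signedDist {n : ℕ} (Ω : Set (EuclideanSpace ℝ (Fin (n + 1))))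
    (x : EuclideanSpace ℝ (Fin (n + 1))) : ℝ :=
  if x ∈ Ω then Metric.infDist x (frontier Ω) else -Metric.infDist x (frontier Ω)

/-- The initial datum `2χ - 1`, with `χ` the indicator function of the compact region `Ω ∪ ∂Ω`
bounded by `M = ∂Ω`. -/
def initialDatum {n : ℕ} (Ω : Set (EuclideanSpace ℝ (Fin (n + 1))))
    (x : EuclideanSpace ℝ (Fin (n + 1))) : ℝ :=
  2 * (closure Ω).indicator (fun _ => (1 : ℝ)) x - 1

/-- `f = F'` for the double-well potential `F(s) = (1 - s²)² / 2`. -/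
def nonlinearity (s : ℝ) : ℝ := 2 * s * (s ^ 2 - 1)

/-- `u` is a solution of the initial value problem
`∂ₜu = Δu - ε⁻² f(u)` on `ℝⁿ⁺¹ × (0, ∞)`, `u(·, 0) = u₀`: it is in `L^∞(ℝⁿ⁺¹ × [0, T])` for every
`T > 0`, is continuous from `[0, ∞)` to the distributions on `ℝⁿ⁺¹`, solves the equation in the
sense of distributions on `ℝⁿ⁺¹ × (0, ∞)`, and has initial value `u₀`. -/
structure IsSolution {n : ℕ} (ε : ℝ) (u₀ : EuclideanSpace ℝ (Fin (n + 1)) → ℝ)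
    (u : EuclideanSpace ℝ (Fin (n + 1)) → ℝ → ℝ) : Prop where
  memLp_top : ∀ T : ℝ, 0 < T →
    MemLp (fun p : EuclideanSpace ℝ (Fin (n + 1)) × ℝ => u p.1 p.2) ⊤
      (volume.restrict (univ ×ˢ Icc 0 T))
  locallyIntegrable : ∀ t : ℝ, 0 ≤ t → LocallyIntegrable (fun x => u x t) volume
  continuous_distrib : ∀ ψ : EuclideanSpace ℝ (Fin (n + 1)) → ℝ,
    ContDiff ℝ ∞ ψ → HasCompactSupport ψ →
      ContinuousOn (fun t : ℝ => ∫ x, u x t * ψ x) (Ici 0)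
  initial : (fun x => u x 0) =ᵐ[volume] u₀
  equation : ∀ φ : EuclideanSpace ℝ (Fin (n + 1)) × ℝ → ℝ,
    ContDiff ℝ ∞ φ → HasCompactSupport φ → tsupport φ ⊆ univ ×ˢ Ioi 0 →
      ∫ p : EuclideanSpace ℝ (Fin (n + 1)) × ℝ in univ ×ˢ Ioi 0,
          u p.1 p.2 * (deriv (fun t => φ (p.1, t)) p.2 +
            Laplacian.laplacian (fun x => φ (x, p.2)) p.1) =
        ∫ p : EuclideanSpace ℝ (Fin (n + 1)) × ℝ in univ ×ˢ Ioi 0,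
          (1 / ε ^ 2) * nonlinearity (u p.1 p.2) * φ p

end AllenCahn

end

/-! If the signed distance at `x` is `R > 0`, then the initial datum equals `1` on the ball `B(x,
R)`, because a ball missing `∂Ω` is connected and cannot leave `Ω`; elsewhere the datum is at least
`-1`. It therefore suffices to put under `u` a subsolution that is at most `1` everywhere and at
most `-1` off this ball, and to evaluate it at `x`. The upper bound follows by applying this to
`-u`, since the nonlinearity is odd.

Two barriers are used. With `b = R/√t - 5√(n+1)`, the choice depends on whether `t/ε²` is below or
above `4(n+1) + (2/5)b²`. For short times `isBarrier_gaussian` takes `1 - h` with `h` an exponential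
growing quadratically away from `x`; the reaction lets `h` grow at rate at most `1/(2ε²)`. For long
times `isBarrier_sphere` wraps the standing wave `tanh` around a sphere with `r² = R²/4 - 6(n+1)t`,
which shrinks faster than its curvature requires. The surplus speed pays for lowering the profile by
a small `δ`, and this lowering brings it to `-1` off the ball. Scalar inequalities then compare the
values at the centre with `tanh b`.

The comparison principle `IsBarrier.le_solution` is the analytic core, since `u` is only a
distributional solution and attains its initial value weakly. Mollified in space, `u` can be
differentiated classically (`IsSolution.hasDerivAt_integral`, `hasSecondLineDeriv_mollify`), so the
maximum principle `nonpos_of_subsolution` applies to barrier minus mollification. The reaction does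
not commute with mollification, and the error involves the unknown supremum of `w - u`. With the
weight `exp(3Kt)` the argument turns a bound with constant `M` into one with `M/2`, and iteration
gives `w ≤ u`. -/

namespace AllenCahn

open Filter Topology

/-! ### Calculus at a maximum and the parabolic maximum principle -/

/-- If `g` attains its maximum over `[0, t]` at the right end point, its derivative there is
nonnegative. -/
theorem deriv_nonneg_of_le_left {g : ℝ → ℝ} {g' t : ℝ} (ht : 0 < t) (hg : HasDerivAt g g' t)
    (hmax : ∀ s ∈ Icc 0 t, g s ≤ g t) : 0 ≤ g' := by
  have h1 : Tendsto (slope g t) (𝓝[<] t) (𝓝 g') :=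
    (hasDerivAt_iff_tendsto_slope.1 hg).mono_left (nhdsLT_le_nhdsNE t)
  refine ge_of_tendsto h1 ?_
  filter_upwards [Ioo_mem_nhdsLT ht] with s hs
  rw [slope_def_field]
  have := hmax s ⟨hs.1.le, hs.2.le⟩
  exact div_nonneg_of_nonpos (by linarith) (by linarith [hs.2])

/-- At a maximum the second derivative is nonpositive. -/
theorem second_deriv_nonpos_of_isMax {g p : ℝ → ℝ} {q : ℝ} (hg : ∀ τ, HasDerivAt g (p τ) τ)
    (hp : HasDerivAt p q 0) (hmax : ∀ τ, g τ ≤ g 0) : q ≤ 0 := by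
  by_contra! hq
  have hdg : deriv g = p := funext fun τ => (hg τ).deriv
  have hlm : IsLocalMax g 0 := Filter.Eventually.of_forall hmax
  have hp0 : deriv g 0 = 0 := hlm.deriv_eq_zero
  -- If `q > 0`, the maximum is also a local minimum, so `g` is locally constant and `q = 0` after
  -- all.
  have hmin : IsLocalMin g 0 := by
    apply isLocalMin_of_deriv_deriv_pos _ hp0 (hg 0).continuousAt
    rw [hdg, hp.deriv]; exact hq
  have hconst : g =ᶠ[𝓝 0] fun _ => g 0 := by
    filter_upwards [hmin] with τ hτ using le_antisymm (hmax τ) hτ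
  have hp' : p =ᶠ[𝓝 0] fun _ => 0 := by
    filter_upwards [hconst.deriv] with τ hτ
    rw [← hdg, hτ]; simp
  have := hp'.deriv_eq
  rw [hp.deriv] at this
  simp at this
  exact hq.ne' this

/-- `f` is differentiable along the line through `x` in direction `v`, with second derivative `q`
at `x`. -/
def HasSecondLineDeriv {E : Type*} [AddCommGroup E] [Module ℝ E]
    (f : E → ℝ) (v x : E) (q : ℝ) : Prop :=
  ∃ p : ℝ → ℝ, (∀ τ : ℝ, HasDerivAt (fun τ : ℝ => f (x + τ • v)) (p τ) τ) ∧ HasDerivAt p q 0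

namespace HasSecondLineDeriv

variable {E : Type*} [AddCommGroup E] [Module ℝ E] {f g : E → ℝ} {v x : E} {q r : ℝ}

theorem sub (hf : HasSecondLineDeriv f v x q) (hg : HasSecondLineDeriv g v x r) :
    HasSecondLineDeriv (fun y => f y - g y) v x (q - r) := by
  obtain ⟨p, h1, h2⟩ := hf
  obtain ⟨p', h1', h2'⟩ := hg
  exact ⟨fun τ => p τ - p' τ, fun τ => (h1 τ).sub (h1' τ), h2.sub h2'⟩

theorem sub_const (hf : HasSecondLineDeriv f v x q) (c : ℝ) :
    HasSecondLineDeriv (fun y => f y - c) v x q := by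
  obtain ⟨p, h1, h2⟩ := hf
  exact ⟨p, fun τ => (h1 τ).sub_const c, h2⟩

theorem nonpos_of_isMax (hf : HasSecondLineDeriv f v x q) (hmax : ∀ y, f y ≤ f x) : q ≤ 0 := by
  obtain ⟨p, h1, h2⟩ := hf
  exact second_deriv_nonpos_of_isMax h1 h2 fun τ => by simpa using hmax (x + τ • v)

end HasSecondLineDeriv

theorem norm_add_smul_single_sq {n : ℕ} (x : EuclideanSpace ℝ (Fin n)) (i : Fin n) (τ : ℝ) :
    ‖x + τ • EuclideanSpace.single i (1 : ℝ)‖ ^ 2 = ‖x‖ ^ 2 + 2 * x i * τ + τ ^ 2 := by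
  rw [norm_add_sq_real, inner_smul_right, norm_smul, EuclideanSpace.inner_single_right]
  simp
  ring

/-- Second line derivatives of a radial function. -/
theorem hasSecondLineDeriv_radial {n : ℕ} {φ φ' : ℝ → ℝ} {φ'' : ℝ} (hφ : ∀ s, HasDerivAt φ (φ' s) s)
    (x₀ x : EuclideanSpace ℝ (Fin n)) (hφ' : HasDerivAt φ' φ'' (‖x - x₀‖ ^ 2)) (i : Fin n) :
    HasSecondLineDeriv (fun y => φ (‖y - x₀‖ ^ 2)) (EuclideanSpace.single i (1 : ℝ)) x
      (4 * φ'' * ((x - x₀) i) ^ 2 + 2 * φ' (‖x - x₀‖ ^ 2)) := by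
  set ρ := ‖x - x₀‖ ^ 2
  set ξ := (x - x₀) i
  have hl : ∀ τ : ℝ, HasDerivAt (fun τ : ℝ => ρ + 2 * ξ * τ + τ ^ 2) (2 * ξ + 2 * τ) τ := by
    intro τ
    have := (((hasDerivAt_id τ).const_mul (2 * ξ)).const_add ρ).add ((hasDerivAt_id τ).pow 2)
    refine (this.congr_deriv ?_)
    simp
  have hl0 := hl 0
  have e : (fun τ : ℝ => φ (‖x + τ • EuclideanSpace.single i (1 : ℝ) - x₀‖ ^ 2)) =
      fun τ => φ (ρ + 2 * ξ * τ + τ ^ 2) := by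
    funext τ
    rw [add_sub_right_comm, norm_add_smul_single_sq]
  refine ⟨fun τ => φ' (ρ + 2 * ξ * τ + τ ^ 2) * (2 * ξ + 2 * τ), fun τ => ?_, ?_⟩
  · rw [e]
    exact (hφ _).comp τ (hl τ)
  · have h0 : ρ + 2 * ξ * 0 + 0 ^ 2 = ρ := by ring
    have h1 : HasDerivAt (fun τ : ℝ => φ' (ρ + 2 * ξ * τ + τ ^ 2)) (φ'' * (2 * ξ + 2 * 0)) 0 := by
      have h2 : HasDerivAt φ' φ'' (ρ + 2 * ξ * 0 + 0 ^ 2) := by rw [h0]; exact hφ'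
      exact h2.comp (0 : ℝ) hl0
    have h3 : HasDerivAt (fun τ : ℝ => 2 * ξ + 2 * τ) 2 0 := by
      simpa using ((hasDerivAt_id (0 : ℝ)).const_mul 2).const_add (2 * ξ)
    refine (h1.mul h3).congr_deriv ?_
    rw [h0]; ring

/-- The sum of the second line derivatives of a radial function. -/
theorem sum_radial {n : ℕ} (x : EuclideanSpace ℝ (Fin n)) (a b : ℝ) :
    ∑ i, (4 * a * (x i) ^ 2 + 2 * b) = 4 * a * ‖x‖ ^ 2 + 2 * n * b := by
  rw [Finset.sum_add_distrib, ← Finset.mul_sum, EuclideanSpace.real_norm_sq_eq]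
  simp; ring

/-- Maximum principle on `ℝⁿ × [0, T]` for functions bounded above. -/
theorem nonpos_of_subsolution {n : ℕ} {T B : ℝ} {Z : EuclideanSpace ℝ (Fin n) → ℝ → ℝ}
    (hcont : ContinuousOn (fun p : EuclideanSpace ℝ (Fin n) × ℝ => Z p.1 p.2) (univ ×ˢ Icc 0 T))
    (hB : ∀ x, ∀ t ∈ Icc 0 T, Z x t ≤ B) (h0 : ∀ x, Z x 0 ≤ 0)
    (hZ : ∀ x, ∀ t ∈ Ioc 0 T, 0 < Z x t → ∃ (z' : ℝ) (q : Fin n → ℝ), HasDerivAt (Z x) z' t ∧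
      (∀ i, HasSecondLineDeriv (fun y => Z y t) (EuclideanSpace.single i 1) x (q i)) ∧
      z' ≤ ∑ i, q i) :
    ∀ x, ∀ t ∈ Icc 0 T, Z x t ≤ 0 := by
  -- The quadratic penalty forces a maximum to be attained. Its time slope `2n + 1` exceeds the
  -- Laplacian `2n` of `‖x‖²`, so the inequalities at the maximum contradict each other strictly.
  have key : ∀ δ : ℝ, 0 < δ → ∀ x, ∀ t ∈ Icc 0 T,
      Z x t ≤ δ * (1 + ‖x‖ ^ 2 + (2 * n + 1) * t) := by
    intro δ hδ
    by_contra! hcon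
    obtain ⟨x₁, t₁, ht₁, hx₁⟩ := hcon
    set P : EuclideanSpace ℝ (Fin n) × ℝ → ℝ :=
      fun p => Z p.1 p.2 - δ * (1 + ‖p.1‖ ^ 2 + (2 * n + 1) * p.2) with hP
    have hPc : ContinuousOn P (univ ×ˢ Icc 0 T) := by
      refine hcont.sub (Continuous.continuousOn ?_)
      fun_prop
    have hB0 : 0 < B := by
      have h1 := hB x₁ t₁ ht₁
      have : 0 ≤ δ * (1 + ‖x₁‖ ^ 2 + (2 * n + 1) * t₁) := by
        have := ht₁.1
        positivity
      linarith
    -- Beyond this radius the penalty exceeds the upper bound `B`, so a positive maximum lies in a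
    -- compact cylinder.
    set r := √(B / δ)
    have hr : ∀ x : EuclideanSpace ℝ (Fin n), ∀ t ∈ Icc 0 T, r < ‖x‖ → P (x, t) < 0 := by
      intro x t ht hx
      have h1 : B / δ < ‖x‖ ^ 2 := by
        have h2 : r ^ 2 = B / δ := Real.sq_sqrt (by positivity)
        rw [← h2]
        have : 0 ≤ r := Real.sqrt_nonneg _
        gcongr
      rw [div_lt_iff₀ hδ] at h1
      have h2 := hB x t ht
      have h3 : 0 ≤ δ * (1 + (2 * n + 1) * t) := by
        have := ht.1
        positivity
      simp only [hP]
      nlinarith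
    have hPpos : 0 < P (x₁, t₁) := by simp only [hP]; linarith
    have hx₁r : ‖x₁‖ ≤ r := by
      by_contra! h
      exact absurd (hr x₁ t₁ ht₁ h) (by linarith)
    obtain ⟨⟨x₂, t₂⟩, hmem, hmax⟩ :=
      ((isCompact_closedBall (0 : EuclideanSpace ℝ (Fin n)) r).prod
        (isCompact_Icc (a := (0 : ℝ)) (b := T))).exists_isMaxOn
        ⟨(x₁, t₁), by simpa using hx₁r, ht₁⟩ (hPc.mono (prod_mono (subset_univ _) le_rfl))
    have ht₂ : t₂ ∈ Icc 0 T := hmem.2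
    have hP₂ : 0 < P (x₂, t₂) := hPpos.trans_le (hmax ⟨by simpa using hx₁r, ht₁⟩)
    have hmax' : ∀ x, ∀ t ∈ Icc 0 T, P (x, t) ≤ P (x₂, t₂) := by
      intro x t ht
      by_cases h : ‖x‖ ≤ r
      · exact hmax ⟨by simpa using h, ht⟩
      · exact ((hr x t ht (not_le.1 h)).trans hP₂).le
    have hZ₂ : 0 < Z x₂ t₂ := by
      have : 0 ≤ δ * (1 + ‖x₂‖ ^ 2 + (2 * n + 1) * t₂) := by
        have := ht₂.1
        positivity
      simp only [hP] at hP₂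
      linarith
    have ht₂0 : 0 < t₂ := by
      rcases ht₂.1.eq_or_lt with h | h
      · rw [← h] at hZ₂
        exact absurd (h0 x₂) (by linarith)
      · exact h
    obtain ⟨z', q, hz', hq, hle⟩ := hZ x₂ t₂ ⟨ht₂0, ht₂.2⟩ hZ₂
    have htime : 0 ≤ z' - δ * (2 * n + 1) := by
      refine deriv_nonneg_of_le_left (g := fun s => P (x₂, s)) ht₂0 ?_
        fun s hs => hmax' x₂ s ⟨hs.1, hs.2.trans ht₂.2⟩
      refine hz'.sub ?_
      have := (((hasDerivAt_id t₂).const_mul (2 * (n : ℝ) + 1)).const_add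
        (1 + ‖x₂‖ ^ 2)).const_mul δ
      simpa using this
    have hspace : ∀ i, q i - 2 * δ ≤ 0 := by
      intro i
      have hφ : ∀ s : ℝ, HasDerivAt (fun s : ℝ => δ * (1 + s + (2 * n + 1) * t₂)) δ s := by
        intro s
        simpa using (((hasDerivAt_id s).const_add 1).add_const ((2 * (n : ℝ) + 1) * t₂)).const_mul δ
      have h1 := hasSecondLineDeriv_radial (φ' := fun _ => δ) hφ 0 x₂ (hasDerivAt_const _ _) i
      have h2 := (hq i).sub h1
      have h3 := h2.nonpos_of_isMax (fun y => by simpa [hP] using hmax' y t₂ ht₂)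
      simpa using h3
    have hsum : ∑ i, (q i - 2 * δ) ≤ 0 := Finset.sum_nonpos fun i _ => hspace i
    rw [Finset.sum_sub_distrib] at hsum
    simp at hsum
    nlinarith
  intro x t ht
  set A := 1 + ‖x‖ ^ 2 + (2 * n + 1) * t
  have hA : 0 < A := by
    have := ht.1
    positivity
  refine le_of_forall_pos_le_add fun η hη => ?_
  have := key (η / A) (by positivity) x t ht
  rw [div_mul_cancel₀ _ hA.ne'] at this
  linarith

/-! ### Weak and classical derivatives in one variable -/

/-- A smooth function supported in `[a, b]` with vanishing integral has a smooth primitive supported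
in `[a, b]`. -/
theorem exists_primitive {g : ℝ → ℝ} (hg : ContDiff ℝ ∞ g) {a b : ℝ} (hab : a ≤ b)
    (hsupp : ∀ t, t ∉ Icc a b → g t = 0) (hint : ∫ t, g t = 0) :
    ∃ θ : ℝ → ℝ, ContDiff ℝ ∞ θ ∧ (∀ t, HasDerivAt θ (g t) t) ∧ ∀ t, t ∉ Icc a b → θ t = 0 := by
  have hgc := hg.continuous
  have hd : ∀ t, HasDerivAt (fun t => ∫ s in a..t, g s) (g t) t := fun t =>
    intervalIntegral.integral_hasDerivAt_right (hgc.intervalIntegrable _ _)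
      (hgc.stronglyMeasurableAtFilter _ _) hgc.continuousAt
  refine ⟨fun t => ∫ s in a..t, g s, ?_, hd, ?_⟩
  · rw [contDiff_infty_iff_deriv]
    refine ⟨fun t => (hd t).differentiableAt, ?_⟩
    have : deriv (fun t => ∫ s in a..t, g s) = g := funext fun t => (hd t).deriv
    rwa [this]
  · intro t ht
    have htot : ∫ s in a..b, g s = 0 := by
      rw [intervalIntegral.integral_of_le hab, ← integral_Icc_eq_integral_Ioc,
        setIntegral_eq_integral_of_forall_compl_eq_zero hsupp, hint]
    have hout : ∀ c d : ℝ, (∀ s ∈ uIoo c d, s ∉ Icc a b) → ∫ s in c..d, g s = 0 := by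
      intro c d h
      rw [intervalIntegral.integral_congr_uIoo (g := fun _ => 0) fun s hs => hsupp s (h s hs)]
      simp
    rcases not_and_or.1 ht with h | h
    · push Not at h
      refine hout _ _ fun s hs hs' => ?_
      rw [uIoo_of_ge h.le] at hs
      linarith [hs.2, hs'.1]
    · push Not at h
      have h1 : ∫ s in b..t, g s = 0 := by
        refine hout _ _ fun s hs hs' => ?_
        rw [uIoo_of_le h.le] at hs
        linarith [hs.1, hs'.2]
      have := intervalIntegral.integral_add_adjacent_intervals
        (hgc.intervalIntegrable a b) (hgc.intervalIntegrable (μ := volume) b t)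
      simp only
      rw [← this, htot, h1, add_zero]

/-- The product of a function continuous on an open set with a continuous function whose compact
topological support lies in that set is continuous. -/
theorem continuous_mul_of_tsupport_subset {X : Type*} [TopologicalSpace X] {U θ : X → ℝ} {s : Set X}
    (hs : IsOpen s) (hU : ContinuousOn U s) (hθ : Continuous θ) (hsupp : tsupport θ ⊆ s) :
    Continuous fun x => U x * θ x := by
  rw [continuous_iff_continuousAt]
  intro x
  by_cases hx : x ∈ s
  · exact ((hU.continuousAt (hs.mem_nhds hx)).mul hθ.continuousAt)
  · have : (fun x => U x * θ x) =ᶠ[𝓝 x] fun _ => 0 := by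
      have h1 := (isClosed_tsupport θ).isOpen_compl.mem_nhds (fun h => hx (hsupp h))
      filter_upwards [h1] with y hy
      rw [image_eq_zero_of_notMem_tsupport hy, mul_zero]
    exact continuousAt_const.congr this.symm

theorem tsupport_subset_Ioi {θ : ℝ → ℝ} {a b : ℝ} (ha : 0 < a) (h : ∀ t, t ∉ Icc a b → θ t = 0) :
    HasCompactSupport θ ∧ tsupport θ ⊆ Ioi 0 := by
  have h1 : tsupport θ ⊆ Icc a b :=
    closure_minimal (fun t ht => by by_contra hh; exact ht (h t hh)) isClosed_Icc
  exact ⟨HasCompactSupport.intro isCompact_Icc h, h1.trans fun t ht => ha.trans_le ht.1⟩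

/-- A compactly supported function with topological support in `(0, ∞)` vanishes off a compact
subinterval of `(0, ∞)`. -/
theorem exists_Icc_of_tsupport_subset {θ : ℝ → ℝ} (hθ : HasCompactSupport θ)
    (hsupp : tsupport θ ⊆ Ioi 0) :
    ∃ a b : ℝ, 0 < a ∧ a ≤ b ∧ ∀ t, t ∉ Icc a b → θ t = 0 := by
  rcases (tsupport θ).eq_empty_or_nonempty with h | h
  · exact ⟨1, 1, one_pos, le_rfl, fun t _ => image_eq_zero_of_notMem_tsupport (by simp [h])⟩
  · obtain ⟨a, ha⟩ := hθ.isCompact.exists_isLeast h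
    obtain ⟨b, hb⟩ := hθ.isCompact.exists_isGreatest h
    refine ⟨a, b, hsupp ha.1, ha.2 hb.1, fun t ht => image_eq_zero_of_notMem_tsupport fun h' => ?_⟩
    exact ht ⟨ha.2 h', hb.2 h'⟩

/-- A continuous function on `(0, ∞)` whose distributional derivative is continuous is
differentiable in the classical sense. -/
theorem hasDerivAt_of_weak_deriv {U V : ℝ → ℝ} (hU : ContinuousOn U (Ioi 0))
    (hV : ContinuousOn V (Ioi 0))
    (h : ∀ θ : ℝ → ℝ, ContDiff ℝ ∞ θ → HasCompactSupport θ → tsupport θ ⊆ Ioi 0 →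
      ∫ t, (U t * deriv θ t + V t * θ t) = 0) {t : ℝ} (ht : 0 < t) : HasDerivAt U (V t) t := by
  have hVi : ∀ a b : ℝ, 0 < a → 0 < b → IntervalIntegrable V volume a b := by
    intro a b ha hb
    refine (hV.mono fun s hs => ?_).intervalIntegrable
    exact (lt_min ha hb).trans_le hs.1
  set I : ℝ → ℝ := fun t => ∫ s in (1 : ℝ)..t, V s with hI
  have hId : ∀ t, 0 < t → HasDerivAt I (V t) t := by
    intro t ht
    refine intervalIntegral.integral_hasDerivAt_right (hVi _ _ one_pos ht) ?_
      (hV.continuousAt (Ioi_mem_nhds ht))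
    exact hV.stronglyMeasurableAtFilter isOpen_Ioi t ht
  have hIc : ContinuousOn I (Ioi 0) := fun t ht => (hId t ht).continuousAt.continuousWithinAt
  set W : ℝ → ℝ := fun t => U t - I t with hW
  have hWc : ContinuousOn W (Ioi 0) := hU.sub hIc
  have hmulint : ∀ {F θ : ℝ → ℝ}, ContinuousOn F (Ioi 0) → Continuous θ → HasCompactSupport θ →
      tsupport θ ⊆ Ioi 0 → Integrable fun t => F t * θ t := by
    intro F θ hF hθ hθc hθs
    exact (continuous_mul_of_tsupport_subset isOpen_Ioi hF hθ hθs).integrable_of_hasCompactSupport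
      hθc.mul_left
  -- A mean-zero `g` is the derivative of an admissible test function, so `W`, having zero weak
  -- derivative, is orthogonal to it.
  have hparts : ∀ g : ℝ → ℝ, ContDiff ℝ ∞ g → ∀ a b : ℝ, 0 < a → a ≤ b →
      (∀ t, t ∉ Icc a b → g t = 0) → ∫ t, g t = 0 → ∫ t, W t * g t = 0 := by
    intro g hg a b ha hab hsupp hint
    obtain ⟨θ, hθ, hθd, hθs⟩ := exists_primitive hg hab hsupp hint
    have hderiv : deriv θ = g := funext fun t => (hθd t).deriv
    obtain ⟨hθc, hθt⟩ := tsupport_subset_Ioi ha hθs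
    obtain ⟨hgc, hgt⟩ := tsupport_subset_Ioi ha hsupp
    have h1 := h θ hθ hθc hθt
    rw [hderiv, integral_add (hmulint hU hg.continuous hgc hgt)
      (hmulint hV hθ.continuous hθc hθt)] at h1
    have hprod : ∀ t, HasDerivAt (fun t => I t * θ t) (V t * θ t + I t * g t) t := by
      intro t
      by_cases ht : 0 < t
      · exact (hId t ht).mul (hθd t)
      · have hnt : t ∉ tsupport θ := fun h => ht (hθt h)
        have hnt' : t ∉ tsupport g := fun h => ht (hgt h)
        rw [image_eq_zero_of_notMem_tsupport hnt, image_eq_zero_of_notMem_tsupport hnt']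
        have : (fun t => I t * θ t) =ᶠ[𝓝 t] fun _ => 0 := by
          filter_upwards [(isClosed_tsupport θ).isOpen_compl.mem_nhds hnt] with y hy
          rw [image_eq_zero_of_notMem_tsupport hy, mul_zero]
        simpa using (hasDerivAt_const t (0 : ℝ)).congr_of_eventuallyEq this
    have h2 : ∫ t, (V t * θ t + I t * g t) = 0 :=
      integral_eq_zero_of_hasDerivAt_of_integrable hprod
        ((hmulint hV hθ.continuous hθc hθt).add (hmulint hIc hg.continuous hgc hgt))
        (hmulint hIc hθ.continuous hθc hθt)
    rw [integral_add (hmulint hV hθ.continuous hθc hθt) (hmulint hIc hg.continuous hgc hgt)] at h2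
    have h3 : ∫ t, W t * g t = (∫ t, U t * g t) - ∫ t, I t * g t := by
      rw [← integral_sub (hmulint hU hg.continuous hgc hgt) (hmulint hIc hg.continuous hgc hgt)]
      simp only [hW, sub_mul]
    rw [h3]; linarith
  obtain ⟨k, hk⟩ : ∃ k : ℝ, ∀ t, 0 < t → W t = k := by
    -- Any test function has mean zero after subtracting a multiple of one fixed bump of mass one,
    -- here supported in `[1, 3]`. Hence `W` equals its average against that bump.
    let β : ContDiffBump (2 : ℝ) := ⟨1 / 2, 1, by norm_num, by norm_num⟩
    set β₀ : ℝ → ℝ := β.normed volume with hβ₀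
    have hβs : ∀ t, t ∉ Icc (1 : ℝ) 3 → β₀ t = 0 := by
      intro t ht
      by_contra hne
      have h1 : t ∈ Function.support β₀ := hne
      rw [hβ₀, β.support_normed_eq, Real.ball_eq_Ioo] at h1
      exact ht ⟨by linarith [h1.1], by linarith [h1.2]⟩
    have hβi : ∫ t, β₀ t = 1 := β.integral_normed
    have hβd : ContDiff ℝ ∞ β₀ := β.contDiff_normed
    obtain ⟨hβc, hβt⟩ := tsupport_subset_Ioi one_pos hβs
    refine ⟨∫ t, W t * β₀ t, ?_⟩
    set k := ∫ t, W t * β₀ t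
    have hae : ∀ᵐ t, t ∈ Ioi (0 : ℝ) → W t - k = 0 := by
      refine IsOpen.ae_eq_zero_of_integral_contDiff_smul_eq_zero isOpen_Ioi
        ((hWc.sub continuousOn_const).locallyIntegrableOn measurableSet_Ioi) ?_
      intro g hg hgc hgt
      obtain ⟨a, b, ha, hab, hs⟩ := exists_Icc_of_tsupport_subset hgc hgt
      have hgi := hg.continuous.integrable_of_hasCompactSupport (μ := volume) hgc
      have hβint := hβd.continuous.integrable_of_hasCompactSupport (μ := volume) hβc
      have h0 := hparts (fun t => g t - (∫ s, g s) * β₀ t) (hg.sub (contDiff_const.mul hβd))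
        (min a 1) (max b 3) (lt_min ha one_pos)
        ((min_le_right _ _).trans ((by norm_num : (1 : ℝ) ≤ 3).trans (le_max_right _ _)))
        (fun t ht => by
          rw [hs t fun h => ht ⟨(min_le_left _ _).trans h.1, h.2.trans (le_max_left _ _)⟩,
            hβs t fun h => ht ⟨(min_le_right _ _).trans h.1, h.2.trans (le_max_right _ _)⟩]
          simp)
        (by rw [integral_sub hgi (hβint.const_mul _), integral_const_mul, hβi]; ring)
      have e1 : (fun t => W t * (g t - (∫ s, g s) * β₀ t)) =
          fun t => W t * g t - (∫ s, g s) * (W t * β₀ t) := by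
        funext t; ring
      rw [e1, integral_sub (hmulint hWc hg.continuous hgc hgt)
        ((hmulint hWc hβd.continuous hβc hβt).const_mul _), integral_const_mul] at h0
      have e2 : (fun t => g t • (W t - k)) = fun t => W t * g t - k * g t := by
        funext t; simp only [smul_eq_mul]; ring
      rw [e2, integral_sub (hmulint hWc hg.continuous hgc hgt) (hgi.const_mul _),
        integral_const_mul]
      linarith
    have hae' : W =ᵐ[volume.restrict (Ioi 0)] fun _ => k := by
      rw [Filter.EventuallyEq, ae_restrict_iff' measurableSet_Ioi]
      filter_upwards [hae] with t ht h' using sub_eq_zero.1 (ht h')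
    have := Measure.eqOn_open_of_ae_eq hae' isOpen_Ioi hWc continuousOn_const
    exact fun t ht => this ht
  have hUeq : U =ᶠ[𝓝 t] fun s => k + I s := by
    filter_upwards [Ioi_mem_nhds ht] with s hs
    have := hk s hs
    simp only [hW] at this
    linarith
  exact ((hId t ht).const_add k).congr_of_eventuallyEq hUeq

/-! ### The equation tested against functions of space, and pointwise bounds -/

section

/-- The derivative of `f` in direction `v`, as a function. -/
noncomputable def dirDeriv {E : Type*} [NormedAddCommGroup E] [NormedSpace ℝ E] (v : E) (f : E → ℝ) :
    E → ℝ :=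
  fun y => fderiv ℝ f y v

section dirDeriv

variable {E : Type*} [NormedAddCommGroup E] [NormedSpace ℝ E] {f : E → ℝ}

theorem contDiff_dirDeriv (hf : ContDiff ℝ ∞ f) (v : E) : ContDiff ℝ ∞ (dirDeriv v f) :=
  (hf.fderiv_right (m := ∞) (by simp)).clm_apply contDiff_const

theorem hasCompactSupport_dirDeriv (hf : HasCompactSupport f) (v : E) :
    HasCompactSupport (dirDeriv v f) :=
  hf.fderiv_apply (𝕜 := ℝ) v

theorem dirDeriv_const_sub (hf : Differentiable ℝ f) (v x : E) :
    dirDeriv v (fun y => f (x - y)) = fun y => -dirDeriv v f (x - y) := by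
  funext y
  have h : HasFDerivAt (fun y => f (x - y)) _ y :=
    (hf (x - y)).hasFDerivAt.comp y ((hasFDerivAt_id y).const_sub x)
  unfold dirDeriv
  rw [h.fderiv]
  simp

theorem dirDeriv_neg (v : E) (f : E → ℝ) : dirDeriv v (fun y => -f y) = fun y => -dirDeriv v f y := by
  funext y
  simp [dirDeriv, fderiv_fun_neg]

theorem dirDeriv_dirDeriv_const_sub (hf : ContDiff ℝ ∞ f) (v x : E) :
    dirDeriv v (dirDeriv v (fun y => f (x - y))) = fun y => dirDeriv v (dirDeriv v f) (x - y) := by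
  rw [dirDeriv_const_sub (hf.differentiable (by simp)), dirDeriv_neg,
    dirDeriv_const_sub ((contDiff_dirDeriv hf v).differentiable (by simp))]
  simp

end dirDeriv

theorem laplacian_eq_sum_dirDeriv {n : ℕ} {ψ : EuclideanSpace ℝ (Fin n) → ℝ}
    (hψ : ContDiff ℝ ∞ ψ) (x : EuclideanSpace ℝ (Fin n)) :
    Laplacian.laplacian ψ x = ∑ i, dirDeriv (EuclideanSpace.single i 1)
      (dirDeriv (EuclideanSpace.single i 1) ψ) x := by
  rw [InnerProductSpace.laplacian_eq_iteratedFDeriv_orthonormalBasis ψ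
    (EuclideanSpace.basisFun (Fin n) ℝ)]
  refine Finset.sum_congr rfl fun i _ => ?_
  rw [iteratedFDeriv_two_apply]
  have hd : DifferentiableAt ℝ (fderiv ℝ ψ) x :=
    ((hψ.fderiv_right (m := ∞) (by simp)).differentiable (by simp)) x
  unfold dirDeriv
  rw [fderiv_clm_apply hd (differentiableAt_const _)]
  simp

theorem continuous_laplacian {n : ℕ} {ψ : EuclideanSpace ℝ (Fin n) → ℝ} (hψ : ContDiff ℝ ∞ ψ) :
    Continuous (Laplacian.laplacian ψ) := by
  rw [funext (laplacian_eq_sum_dirDeriv hψ)]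
  exact continuous_finsetSum _ fun i _ => (contDiff_dirDeriv (contDiff_dirDeriv hψ _) _).continuous

theorem laplacian_eq_zero_of_notMem_tsupport {n : ℕ} {ψ : EuclideanSpace ℝ (Fin n) → ℝ}
    {x : EuclideanSpace ℝ (Fin n)} (hx : x ∉ tsupport ψ) : Laplacian.laplacian ψ x = 0 := by
  have h : ψ =ᶠ[𝓝 x] fun _ => (0 : ℝ) := by
    filter_upwards [(isClosed_tsupport ψ).isOpen_compl.mem_nhds hx] with y hy
      using image_eq_zero_of_notMem_tsupport hy
  have := (InnerProductSpace.laplacian_congr_nhds h).eq_of_nhds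
  rw [this]
  simp [InnerProductSpace.laplacian_const]

theorem hasCompactSupport_laplacian {n : ℕ} {ψ : EuclideanSpace ℝ (Fin n) → ℝ}
    (hψ : HasCompactSupport ψ) : HasCompactSupport (Laplacian.laplacian ψ) :=
  HasCompactSupport.intro hψ fun _ hx => laplacian_eq_zero_of_notMem_tsupport hx

section tensor

variable {E : Type*} [TopologicalSpace E] {ψ : E → ℝ} {θ : ℝ → ℝ}

theorem tsupport_tensor_subset :
    tsupport (fun p : E × ℝ => ψ p.1 * θ p.2) ⊆ tsupport ψ ×ˢ tsupport θ := by
  refine closure_minimal (fun p hp => ?_) ((isClosed_tsupport ψ).prod (isClosed_tsupport θ))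
  exact ⟨subset_tsupport _ (left_ne_zero_of_mul hp), subset_tsupport _ (right_ne_zero_of_mul hp)⟩

theorem hasCompactSupport_tensor (hψ : HasCompactSupport ψ) (hθ : HasCompactSupport θ) :
    HasCompactSupport (fun p : E × ℝ => ψ p.1 * θ p.2) :=
  (hψ.isCompact.prod hθ.isCompact).of_isClosed_subset (isClosed_tsupport _) tsupport_tensor_subset

end tensor

theorem integrable_mul_tensor {n : ℕ} {F : EuclideanSpace ℝ (Fin n) × ℝ → ℝ}
    {ψ : EuclideanSpace ℝ (Fin n) → ℝ} {θ : ℝ → ℝ} (hF : ContinuousOn F (univ ×ˢ Ioi 0))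
    (hψ : Continuous ψ) (hψc : HasCompactSupport ψ) (hθ : Continuous θ)
    (hθc : HasCompactSupport θ) (hθt : tsupport θ ⊆ Ioi 0) :
    Integrable fun p => F p * (ψ p.1 * θ p.2) := by
  refine (continuous_mul_of_tsupport_subset (isOpen_univ.prod isOpen_Ioi) hF (by fun_prop)
    ?_).integrable_of_hasCompactSupport (hasCompactSupport_tensor hψc hθc).mul_left
  exact tsupport_tensor_subset.trans (prod_mono (subset_univ _) hθt)

theorem continuous_nonlinearity : Continuous nonlinearity := by
  unfold nonlinearity; fun_prop

variable {n : ℕ} {ε : ℝ} {u₀ : EuclideanSpace ℝ (Fin (n + 1)) → ℝ}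
  {u : EuclideanSpace ℝ (Fin (n + 1)) → ℝ → ℝ}

/-- Testing a solution with `ψ` gives a function of time that is differentiable for positive
times. -/
theorem IsSolution.hasDerivAt_integral (hu : IsSolution ε u₀ u)
    (hcont : ContinuousOn (fun p : EuclideanSpace ℝ (Fin (n + 1)) × ℝ => u p.1 p.2)
      (univ ×ˢ Ioi 0)) {ψ : EuclideanSpace ℝ (Fin (n + 1)) → ℝ} (hψ : ContDiff ℝ ∞ ψ)
    (hψc : HasCompactSupport ψ) {t : ℝ} (ht : 0 < t) :
    HasDerivAt (fun t => ∫ x, u x t * ψ x)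
      (∫ x, (u x t * Laplacian.laplacian ψ x - 1 / ε ^ 2 * nonlinearity (u x t) * ψ x)) t := by
  have hfcont : ContinuousOn (fun p : EuclideanSpace ℝ (Fin (n + 1)) × ℝ =>
      1 / ε ^ 2 * nonlinearity (u p.1 p.2)) (univ ×ˢ Ioi 0) :=
    continuousOn_const.mul (continuous_nonlinearity.comp_continuousOn hcont)
  have hslice : ∀ {F : EuclideanSpace ℝ (Fin (n + 1)) × ℝ → ℝ}, ContinuousOn F (univ ×ˢ Ioi 0) →
      ∀ s : ℝ, 0 < s → Continuous fun x => F (x, s) := fun hF s hs =>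
    hF.comp_continuous (by fun_prop) fun x => ⟨mem_univ _, hs⟩
  have hΔ := continuous_laplacian hψ
  have hΔc := hasCompactSupport_laplacian hψc
  have hint : ∀ {F : EuclideanSpace ℝ (Fin (n + 1)) × ℝ → ℝ}
      {χ : EuclideanSpace ℝ (Fin (n + 1)) → ℝ}, ContinuousOn F (univ ×ˢ Ioi 0) → Continuous χ →
      HasCompactSupport χ → ∀ s : ℝ, 0 < s → Integrable fun x => F (x, s) * χ x :=
    fun hF hχ hχc s hs => ((hslice hF s hs).mul hχ).integrable_of_hasCompactSupport hχc.mul_left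
  refine hasDerivAt_of_weak_deriv (V := fun t => ∫ x, (u x t * Laplacian.laplacian ψ x -
    1 / ε ^ 2 * nonlinearity (u x t) * ψ x)) ((hu.continuous_distrib ψ hψ hψc).mono Ioi_subset_Ici_self)
    ?_ ?_ ht
  · have hsw : ContinuousOn (fun p : ℝ × EuclideanSpace ℝ (Fin (n + 1)) => u p.2 p.1)
        (Ioi 0 ×ˢ univ) :=
      hcont.comp (f := fun p : ℝ × EuclideanSpace ℝ (Fin (n + 1)) => (p.2, p.1)) (by fun_prop)
        fun p hp => ⟨mem_univ _, hp.1⟩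
    have hswf : ContinuousOn (fun p : ℝ × EuclideanSpace ℝ (Fin (n + 1)) =>
        1 / ε ^ 2 * nonlinearity (u p.2 p.1)) (Ioi 0 ×ˢ univ) :=
      hfcont.comp (f := fun p : ℝ × EuclideanSpace ℝ (Fin (n + 1)) => (p.2, p.1)) (by fun_prop)
        fun p hp => ⟨mem_univ _, hp.1⟩
    refine continuousOn_integral_of_compact_support (k := tsupport ψ) hψc ?_ ?_
    · exact (hsw.mul (hΔ.comp continuous_snd).continuousOn).sub
        (hswf.mul (hψ.continuous.comp continuous_snd).continuousOn)
    · intro s x _ hx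
      rw [laplacian_eq_zero_of_notMem_tsupport hx, image_eq_zero_of_notMem_tsupport hx]
      simp
  -- The product `ψ(x)θ(t)` is an admissible test function. Integrating in space first turns the
  -- weak equation into a weak equation in time alone.
  · intro θ hθ hθc hθt
    have hθ' : Continuous (deriv θ) := hθ.continuous_deriv (by simp)
    have hθ'c : HasCompactSupport (deriv θ) := hθc.deriv
    have hθ't : tsupport (deriv θ) ⊆ Ioi 0 := (tsupport_deriv_subset (f := θ)).trans hθt
    have heq := hu.equation (fun p => ψ p.1 * θ p.2)
      ((hψ.comp contDiff_fst).mul (hθ.comp contDiff_snd)) (hasCompactSupport_tensor hψc hθc)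
      (tsupport_tensor_subset.trans (prod_mono (subset_univ _) hθt))
    have hθz : ∀ s : ℝ, s ∉ Ioi (0 : ℝ) → θ s = 0 ∧ deriv θ s = 0 := fun s hs =>
      ⟨image_eq_zero_of_notMem_tsupport fun h => hs (hθt h),
        image_eq_zero_of_notMem_tsupport fun h => hs (hθ't h)⟩
    have hd : ∀ p : EuclideanSpace ℝ (Fin (n + 1)) × ℝ,
        deriv (fun t => ψ p.1 * θ t) p.2 = ψ p.1 * deriv θ p.2 := fun p => by
      rw [deriv_const_mul_field]
    have hl : ∀ p : EuclideanSpace ℝ (Fin (n + 1)) × ℝ,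
        Laplacian.laplacian (fun x => ψ x * θ p.2) p.1 =
          Laplacian.laplacian ψ p.1 * θ p.2 := fun p => by
      have h1 : (fun x => ψ x * θ p.2) = θ p.2 • ψ := by
        funext x; simp [mul_comm]
      rw [h1, InnerProductSpace.laplacian_smul _ (hψ.contDiffAt.of_le (by norm_cast))]
      simp [mul_comm]
    simp only [hd, hl] at heq
    rw [setIntegral_eq_integral_of_forall_compl_eq_zero (fun p hp => by
        have h1 := hθz p.2 fun h => hp ⟨mem_univ _, h⟩
        simp [h1.1, h1.2]),
      setIntegral_eq_integral_of_forall_compl_eq_zero (fun p hp => by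
        have h1 := hθz p.2 fun h => hp ⟨mem_univ _, h⟩
        simp [h1.1])] at heq
    have i1 := integrable_mul_tensor hcont hψ.continuous hψc hθ' hθ'c hθ't
    have i2 := integrable_mul_tensor hcont hΔ hΔc hθ.continuous hθc hθt
    have i3 := integrable_mul_tensor hfcont hψ.continuous hψc hθ.continuous hθc hθt
    have i12 : Integrable fun p : EuclideanSpace ℝ (Fin (n + 1)) × ℝ =>
        u p.1 p.2 * (ψ p.1 * deriv θ p.2) + u p.1 p.2 * (Laplacian.laplacian ψ p.1 * θ p.2) :=
      i1.add i2
    have i123 : Integrable (fun p : EuclideanSpace ℝ (Fin (n + 1)) × ℝ =>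
        (u p.1 p.2 * (ψ p.1 * deriv θ p.2) + u p.1 p.2 * (Laplacian.laplacian ψ p.1 * θ p.2)) -
          1 / ε ^ 2 * nonlinearity (u p.1 p.2) * (ψ p.1 * θ p.2)) (volume.prod volume) :=
      i12.sub i3
    have hzero : ∫ p : EuclideanSpace ℝ (Fin (n + 1)) × ℝ,
        ((u p.1 p.2 * (ψ p.1 * deriv θ p.2) + u p.1 p.2 * (Laplacian.laplacian ψ p.1 * θ p.2)) -
          1 / ε ^ 2 * nonlinearity (u p.1 p.2) * (ψ p.1 * θ p.2)) = 0 := by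
      rw [integral_sub i12 i3, sub_eq_zero, ← heq]
      simp only [mul_add]
    rw [Measure.volume_eq_prod, integral_prod_symm _ i123] at hzero
    rw [← hzero]
    refine integral_congr_ae (Eventually.of_forall fun s => ?_)
    by_cases hs : 0 < s
    · have j1 := hint hcont hψ.continuous hψc s hs
      have j2 := hint hcont hΔ hΔc s hs
      have j3 := hint hfcont hψ.continuous hψc s hs
      simp only at j1 j2 j3 ⊢
      rw [integral_sub j2 j3]
      have e : (fun x => (u x s * (ψ x * deriv θ s) + u x s * (Laplacian.laplacian ψ x * θ s)) -
          1 / ε ^ 2 * nonlinearity (u x s) * (ψ x * θ s)) = fun x =>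
          (u x s * ψ x * deriv θ s + u x s * Laplacian.laplacian ψ x * θ s) -
          1 / ε ^ 2 * nonlinearity (u x s) * ψ x * θ s := by
        funext x; ring
      have j12 : Integrable fun x =>
          u x s * ψ x * deriv θ s + u x s * Laplacian.laplacian ψ x * θ s :=
        (j1.mul_const _).add (j2.mul_const _)
      rw [e, integral_sub j12 (j3.mul_const _),
        integral_add (j1.mul_const _) (j2.mul_const _), integral_mul_const, integral_mul_const,
        integral_mul_const]
      ring
    · have h1 := hθz s hs
      simp [h1.1, h1.2]

/-- A solution that is continuous for positive times is bounded on `ℝⁿ⁺¹ × (0, T]`. -/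
theorem IsSolution.exists_abs_le (hu : IsSolution ε u₀ u)
    (hcont : ContinuousOn (fun p : EuclideanSpace ℝ (Fin (n + 1)) × ℝ => u p.1 p.2)
      (univ ×ˢ Ioi 0)) {T : ℝ} (hT : 0 < T) :
    ∃ L : ℝ, ∀ x, ∀ t ∈ Ioc 0 T, |u x t| ≤ L := by
  -- The longer interval makes the final time `T` interior, so that the almost everywhere bound can
  -- be upgraded on an open set.
  have hm := hu.memLp_top (T + 1) (by linarith)
  obtain ⟨L, hL⟩ : ∃ L : ℝ, ∀ᵐ p : EuclideanSpace ℝ (Fin (n + 1)) × ℝ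
      ∂(volume.restrict (univ ×ˢ Icc 0 (T + 1))), |u p.1 p.2| ≤ L := by
    have h1 := hm.2
    refine ⟨(eLpNorm (fun p : EuclideanSpace ℝ (Fin (n + 1)) × ℝ => u p.1 p.2) ⊤
      (volume.restrict (univ ×ˢ Icc 0 (T + 1)))).toReal, ?_⟩
    rw [eLpNorm_exponent_top] at h1 ⊢
    filter_upwards [enorm_ae_le_eLpNormEssSup (fun p : EuclideanSpace ℝ (Fin (n + 1)) × ℝ =>
      u p.1 p.2) (volume.restrict (univ ×ˢ Icc 0 (T + 1)))] with p hp
    have := ENNReal.toReal_mono h1.ne hp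
    simpa using this
  refine ⟨L, fun x t ht => ?_⟩
  by_contra! hlt
  set S : Set (EuclideanSpace ℝ (Fin (n + 1)) × ℝ) := univ ×ˢ Ioo 0 (T + 1)
  have hSo : IsOpen S := isOpen_univ.prod isOpen_Ioo
  have hO : IsOpen (S ∩ (fun p : EuclideanSpace ℝ (Fin (n + 1)) × ℝ => |u p.1 p.2|) ⁻¹' Ioi L) := by
    refine ContinuousOn.isOpen_inter_preimage ?_ hSo isOpen_Ioi
    exact (hcont.mono (prod_mono le_rfl fun s hs => hs.1)).abs
  -- By continuity the set where the bound fails is open; being null, it is empty.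
  have hnull : volume (S ∩ (fun p : EuclideanSpace ℝ (Fin (n + 1)) × ℝ => |u p.1 p.2|) ⁻¹' Ioi L)
      = 0 := by
    have h1 := ae_restrict_of_ae_restrict_of_subset
      (prod_mono le_rfl Ioo_subset_Icc_self : S ⊆ _) hL
    rw [ae_restrict_iff' hSo.measurableSet] at h1
    refine measure_mono_null (fun p hp => ?_) h1
    simp only [mem_compl_iff, mem_ofPred_eq]
    intro h
    exact absurd (h hp.1) (not_le.2 hp.2)
  rw [hO.measure_eq_zero_iff volume] at hnull
  have : (x, t) ∈ (∅ : Set (EuclideanSpace ℝ (Fin (n + 1)) × ℝ)) := by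
    rw [← hnull]
    exact ⟨⟨mem_univ _, ht.1, by linarith [ht.2]⟩, hlt⟩
  exact this

end

/-! ### Mollification in space -/

section mollify

variable {n : ℕ} {f : EuclideanSpace ℝ (Fin n) → ℝ} {ρ : EuclideanSpace ℝ (Fin n) → ℝ}

theorem hasCompactSupport_const_sub (hρ : HasCompactSupport ρ) (x : EuclideanSpace ℝ (Fin n)) :
    HasCompactSupport fun y => ρ (x - y) :=
  hρ.comp_homeomorph (Homeomorph.subLeft x)

theorem integrable_mul_const_sub (hf : LocallyIntegrable f) (hρ : Continuous ρ)
    (hρc : HasCompactSupport ρ) (x : EuclideanSpace ℝ (Fin n)) :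
    Integrable fun y => f y * ρ (x - y) :=
  hf.integrable_smul_right_of_hasCompactSupport (hρ.comp (continuous_const.sub continuous_id))
    (hasCompactSupport_const_sub hρc x)

/-- All derivatives fall on the smooth kernel, so local integrability of `f` is enough; applied
again to the differentiated kernel, this gives second derivatives. -/
theorem hasDerivAt_mollify (hf : LocallyIntegrable f) (hρ : ContDiff ℝ ∞ ρ)
    (hρc : HasCompactSupport ρ) (v x : EuclideanSpace ℝ (Fin n)) (τ : ℝ) :
    HasDerivAt (fun τ : ℝ => ∫ y, f y * ρ (x + τ • v - y))
      (∫ y, f y * dirDeriv v ρ (x + τ • v - y)) τ := by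
  have h1 := hρc.hasFDerivAt_convolution_right (ContinuousLinearMap.mul ℝ ℝ) hf
    (hρ.of_le (by norm_cast)) (x + τ • v)
  have h2 : HasDerivAt (fun τ : ℝ => x + τ • v) v τ := by
    simpa using ((hasDerivAt_id τ).smul_const v).const_add x
  have h3 := h1.comp_hasDerivAt τ h2
  rw [convolution_precompR_apply _ hf (hρc.fderiv ℝ) (hρ.continuous_fderiv (by simp))] at h3
  exact h3

theorem hasSecondLineDeriv_mollify (hf : LocallyIntegrable f) (hρ : ContDiff ℝ ∞ ρ)
    (hρc : HasCompactSupport ρ) (v x : EuclideanSpace ℝ (Fin n)) :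
    HasSecondLineDeriv (fun x => ∫ y, f y * ρ (x - y)) v x
      (∫ y, f y * dirDeriv v (dirDeriv v ρ) (x - y)) := by
  refine ⟨fun τ => ∫ y, f y * dirDeriv v ρ (x + τ • v - y),
    fun τ => hasDerivAt_mollify hf hρ hρc v x τ, ?_⟩
  simpa using hasDerivAt_mollify hf (contDiff_dirDeriv hρ v) (hasCompactSupport_dirDeriv hρc v) v x 0

/-- A nonnegative kernel of mass one forms an average. The almost everywhere form is needed at time
zero, where the solution is known only up to null sets. -/
theorem le_mollify (hf : LocallyIntegrable f) (hρ : Continuous ρ) (hρc : HasCompactSupport ρ)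
    (hρ0 : ∀ y, 0 ≤ ρ y) (hρ1 : ∫ y, ρ y = 1) {x : EuclideanSpace ℝ (Fin n)} {c : ℝ}
    (h : ∀ᵐ y, ρ (x - y) ≠ 0 → c ≤ f y) : c ≤ ∫ y, f y * ρ (x - y) := by
  have h1 : ∫ y, c * ρ (x - y) = c := by
    rw [integral_const_mul, integral_sub_left_eq_self ρ volume x, hρ1, mul_one]
  rw [← h1]
  refine integral_mono_ae (integrable_mul_const_sub (locallyIntegrable_const c) hρ hρc x)
    (integrable_mul_const_sub hf hρ hρc x) ?_
  filter_upwards [h] with y hy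
  by_cases h0 : ρ (x - y) = 0
  · simp [h0]
  · exact mul_le_mul_of_nonneg_right (hy h0) (hρ0 _)

theorem mollify_le (hf : LocallyIntegrable f) (hρ : Continuous ρ) (hρc : HasCompactSupport ρ)
    (hρ0 : ∀ y, 0 ≤ ρ y) (hρ1 : ∫ y, ρ y = 1) {x : EuclideanSpace ℝ (Fin n)} {c : ℝ}
    (h : ∀ᵐ y, ρ (x - y) ≠ 0 → f y ≤ c) : ∫ y, f y * ρ (x - y) ≤ c := by
  have := le_mollify (f := fun y => -f y) (c := -c) hf.neg hρ hρc hρ0 hρ1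
    (h.mono fun y hy h0 => neg_le_neg (hy h0))
  simp only [neg_mul, integral_neg] at this
  linarith

/-- Joint continuity of the spatial mollification of a bounded function that is continuous in time
with values in distributions. -/
theorem continuousOn_mollify {u : EuclideanSpace ℝ (Fin n) → ℝ → ℝ} {A T : ℝ}
    (hu : ∀ t ∈ Icc 0 T, LocallyIntegrable fun x => u x t)
    (hA : ∀ t ∈ Icc 0 T, ∀ᵐ x, |u x t| ≤ A) (hρ : Continuous ρ) (hρc : HasCompactSupport ρ)
    (hut : ∀ x, ContinuousOn (fun t => ∫ y, u y t * ρ (x - y)) (Icc 0 T)) :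
    ContinuousOn (fun p : EuclideanSpace ℝ (Fin n) × ℝ => ∫ y, u y p.2 * ρ (p.1 - y))
      (univ ×ˢ Icc 0 T) := by
  rintro ⟨x₀, t₀⟩ ⟨-, ht₀⟩
  -- The `L¹` distance between two translates of the kernel: times `A`, it bounds the variation in
  -- `x` uniformly in `t`, so continuity in time at the fixed point `x₀` gives joint continuity.
  set m : EuclideanSpace ℝ (Fin n) → ℝ := fun x => ∫ y, |ρ (x - y) - ρ (x₀ - y)| with hm
  have hmc : ContinuousAt m x₀ := by
    have h1 : ContinuousOn m (Metric.closedBall x₀ 1) := by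
      refine continuousOn_integral_of_compact_support
        (k := (fun p : EuclideanSpace ℝ (Fin n) × EuclideanSpace ℝ (Fin n) => p.1 - p.2) ''
          (Metric.closedBall x₀ 1 ×ˢ tsupport ρ)) ?_ ?_ ?_
      · exact ((isCompact_closedBall x₀ 1).prod hρc.isCompact).image (by fun_prop)
      · refine Continuous.continuousOn ?_
        unfold Function.uncurry
        fun_prop
      · intro x y hx hy
        have hz : ∀ x ∈ Metric.closedBall x₀ 1, ρ (x - y) = 0 := by
          intro x hx
          refine image_eq_zero_of_notMem_tsupport fun h => hy ⟨(x, x - y), ⟨hx, h⟩, by simp⟩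
        rw [hz x hx, hz x₀ (Metric.mem_closedBall_self zero_le_one)]
        simp
    exact h1.continuousAt (Metric.closedBall_mem_nhds x₀ one_pos)
  have hm0 : m x₀ = 0 := by simp [hm]
  have hbound : ∀ x, ∀ t ∈ Icc 0 T,
      |(∫ y, u y t * ρ (x - y)) - ∫ y, u y t * ρ (x₀ - y)| ≤ A * m x := by
    intro x t ht
    rw [← integral_sub (integrable_mul_const_sub (hu t ht) hρ hρc x)
      (integrable_mul_const_sub (hu t ht) hρ hρc x₀)]
    have hi : Integrable fun y => |ρ (x - y) - ρ (x₀ - y)| := by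
      have h1 := integrable_mul_const_sub (locallyIntegrable_const (1 : ℝ)) hρ hρc x
      have h2 := integrable_mul_const_sub (locallyIntegrable_const (1 : ℝ)) hρ hρc x₀
      simp only [one_mul] at h1 h2
      exact (h1.sub h2).abs
    rw [hm, ← integral_const_mul, ← Real.norm_eq_abs]
    refine norm_integral_le_of_norm_le (hi.const_mul A) ?_
    filter_upwards [hA t ht] with y hy
    rw [← mul_sub, Real.norm_eq_abs, abs_mul]
    exact mul_le_mul_of_nonneg_right hy (abs_nonneg _)
  have h1 : Tendsto (fun p : EuclideanSpace ℝ (Fin n) × ℝ =>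
      (∫ y, u y p.2 * ρ (p.1 - y)) - ∫ y, u y p.2 * ρ (x₀ - y))
      (𝓝[univ ×ˢ Icc 0 T] (x₀, t₀)) (𝓝 0) := by
    have h2 : Tendsto (fun p : EuclideanSpace ℝ (Fin n) × ℝ => A * m p.1)
        (𝓝[univ ×ˢ Icc 0 T] (x₀, t₀)) (𝓝 0) := by
      have h3 : Tendsto (fun p : EuclideanSpace ℝ (Fin n) × ℝ => p.1)
          (𝓝[univ ×ˢ Icc 0 T] (x₀, t₀)) (𝓝 x₀) := continuous_fst.continuousAt.continuousWithinAt
      have h4 := (hmc.tendsto.comp h3).const_mul A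
      rw [hm0, mul_zero] at h4
      exact h4
    refine squeeze_zero_norm' ?_ h2
    filter_upwards [self_mem_nhdsWithin] with p hp using hbound p.1 p.2 hp.2
  have h2 : Tendsto (fun p : EuclideanSpace ℝ (Fin n) × ℝ => ∫ y, u y p.2 * ρ (x₀ - y))
      (𝓝[univ ×ˢ Icc 0 T] (x₀, t₀)) (𝓝 (∫ y, u y t₀ * ρ (x₀ - y))) := by
    refine (hut x₀ t₀ ht₀).tendsto.comp (f := fun p : EuclideanSpace ℝ (Fin n) × ℝ => p.2) ?_
    refine tendsto_nhdsWithin_of_tendsto_nhds_of_eventually_within _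
      continuous_snd.continuousAt.continuousWithinAt ?_
    filter_upwards [self_mem_nhdsWithin] with p hp using hp.2
  have h3 := h1.add h2
  simpa [ContinuousWithinAt] using h3

/-- Smooth mollifiers with arbitrarily small support. -/
theorem exists_mollifier (n : ℕ) {η : ℝ} (hη : 0 < η) :
    ∃ ρ : EuclideanSpace ℝ (Fin n) → ℝ, ContDiff ℝ ∞ ρ ∧ HasCompactSupport ρ ∧ (∀ y, 0 ≤ ρ y) ∧
      ∫ y, ρ y = 1 ∧ ∀ y, ρ y ≠ 0 → ‖y‖ < η := by
  let β : ContDiffBump (0 : EuclideanSpace ℝ (Fin n)) := ⟨η / 2, η, by linarith, by linarith⟩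
  refine ⟨β.normed volume, β.contDiff_normed, β.hasCompactSupport_normed, β.nonneg_normed,
    β.integral_normed, fun y hy => ?_⟩
  have : y ∈ Function.support (β.normed volume) := hy
  rw [β.support_normed_eq] at this
  simpa using this

end mollify

/-! ### Comparison of barriers with weak solutions -/

/-- The reaction term becomes monotone after adding a large linear term. -/
theorem exists_monotone_shift (ε A : ℝ) (hε : 0 < ε) : ∃ K : ℝ, 0 < K ∧ ∀ a b : ℝ, |a| ≤ A →
    |b| ≤ A → a ≤ b →
    0 ≤ K * (b - a) - 1 / ε ^ 2 * (nonlinearity b - nonlinearity a) ∧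
    K * (b - a) - 1 / ε ^ 2 * (nonlinearity b - nonlinearity a) ≤ 2 * K * (b - a) := by
  have hc : 0 < 1 / ε ^ 2 := by positivity
  set c := 1 / ε ^ 2
  -- The difference quotient of the nonlinearity is `2(a² + ab + b² - 1)`, which lies between `-2`
  -- and `6A² - 2` on `[-A, A]`.
  refine ⟨c * (6 * A ^ 2 + 2), by positivity, fun a b ha hb hab => ?_⟩
  have e : c * (6 * A ^ 2 + 2) * (b - a) - c * (nonlinearity b - nonlinearity a) =
      c * (b - a) * (6 * A ^ 2 + 2 - 2 * (a ^ 2 + a * b + b ^ 2 - 1)) := by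
    unfold nonlinearity; ring
  have ha2 : a ^ 2 ≤ A ^ 2 := sq_le_sq' (abs_le.1 ha).1 (abs_le.1 ha).2
  have hb2 : b ^ 2 ≤ A ^ 2 := sq_le_sq' (abs_le.1 hb).1 (abs_le.1 hb).2
  have h1 : a ^ 2 + a * b + b ^ 2 ≤ 3 * A ^ 2 := by nlinarith [sq_nonneg (a - b)]
  have h2 : 0 ≤ a ^ 2 + a * b + b ^ 2 := by nlinarith [sq_nonneg (a + b), sq_nonneg a, sq_nonneg b]
  have h3 : 0 ≤ c * (b - a) := mul_nonneg hc.le (by linarith)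
  rw [e]
  constructor
  · exact mul_nonneg h3 (by linarith)
  · have : c * (b - a) * (6 * A ^ 2 + 2 - 2 * (a ^ 2 + a * b + b ^ 2 - 1)) ≤
        c * (b - a) * (2 * (6 * A ^ 2 + 2)) :=
      mul_le_mul_of_nonneg_left (by nlinarith [sq_nonneg A]) h3
    linarith

variable {n : ℕ} {ε : ℝ} {u₀ : EuclideanSpace ℝ (Fin (n + 1)) → ℝ}
  {u : EuclideanSpace ℝ (Fin (n + 1)) → ℝ → ℝ}

theorem continuous_slice
    (hcont : ContinuousOn (fun p : EuclideanSpace ℝ (Fin (n + 1)) × ℝ => u p.1 p.2)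
      (univ ×ˢ Ioi 0)) {t : ℝ} (ht : 0 < t) : Continuous fun y => u y t :=
  hcont.comp_continuous (f := fun y => (y, t)) (by fun_prop) fun _ => ⟨mem_univ _, ht⟩

/-- `w` is, on the set where it exceeds `-ℓ`, a classical subsolution of the Allen–Cahn equation on
`ℝⁿ⁺¹ × (0, T]`; its truncation at `-ℓ` is uniformly continuous in space, and it is bounded above
by `L`. -/
structure IsBarrier (ε ℓ L T : ℝ) (w : EuclideanSpace ℝ (Fin (n + 1)) → ℝ → ℝ) : Prop where
  continuousOn : ContinuousOn (fun p : EuclideanSpace ℝ (Fin (n + 1)) × ℝ => w p.1 p.2)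
    (univ ×ˢ Icc 0 T)
  le : ∀ x, ∀ t ∈ Icc 0 T, w x t ≤ L
  uniform : ∀ κ : ℝ, 0 < κ → ∃ η : ℝ, 0 < η ∧ ∀ t ∈ Icc 0 T, ∀ x y, ‖x - y‖ < η →
    |max (w x t) (-ℓ) - max (w y t) (-ℓ)| ≤ κ
  subsolution : ∀ x, ∀ t ∈ Ioc 0 T, -ℓ < w x t → ∃ (w' : ℝ) (q : Fin (n + 1) → ℝ),
    HasDerivAt (w x) w' t ∧
    (∀ i, HasSecondLineDeriv (fun y => w y t) (EuclideanSpace.single i 1) x (q i)) ∧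
    w' ≤ ∑ i, q i - 1 / ε ^ 2 * nonlinearity (w x t)

/-- The mollified difference of a barrier and a solution is controlled by the maximum principle. -/
theorem IsBarrier.sub_mollify_le (hu : IsSolution ε u₀ u)
    (hcont : ContinuousOn (fun p : EuclideanSpace ℝ (Fin (n + 1)) × ℝ => u p.1 p.2)
      (univ ×ˢ Ioi 0)) {ℓ L T A K M κ η : ℝ} {w : EuclideanSpace ℝ (Fin (n + 1)) → ℝ → ℝ}
    (hw : IsBarrier ε ℓ L T w) (hℓA : |ℓ| ≤ A) (hLA : |L| ≤ A) (hℓL : -ℓ ≤ L) (hK : 0 < K)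
    (hmono : ∀ a b : ℝ, |a| ≤ A → |b| ≤ A → a ≤ b →
      0 ≤ K * (b - a) - 1 / ε ^ 2 * (nonlinearity b - nonlinearity a) ∧
      K * (b - a) - 1 / ε ^ 2 * (nonlinearity b - nonlinearity a) ≤ 2 * K * (b - a))
    (hub : ∀ x, ∀ t ∈ Ioc 0 T, -ℓ ≤ u x t ∧ u x t ≤ L) (hub₀ : ∀ᵐ x, -ℓ ≤ u x 0 ∧ u x 0 ≤ L)
    (hw₀ : ∀ᵐ x, w x 0 ≤ u x 0) (hT : 0 ≤ T) (hM : 0 ≤ M) (hκ : 0 < κ)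
    (hη : ∀ t ∈ Icc 0 T, ∀ x y, ‖x - y‖ < η → |max (w x t) (-ℓ) - max (w y t) (-ℓ)| ≤ κ / 2)
    (hwM : ∀ x, ∀ t ∈ Ioc 0 T, w x t - u x t ≤ M * Real.exp (3 * K * t))
    {ρ : EuclideanSpace ℝ (Fin (n + 1)) → ℝ} (hρ : ContDiff ℝ ∞ ρ) (hρc : HasCompactSupport ρ)
    (hρ0 : ∀ y, 0 ≤ ρ y) (hρ1 : ∫ y, ρ y = 1) (hρη : ∀ y, ρ y ≠ 0 → ‖y‖ < η) :
    ∀ x, ∀ t ∈ Icc 0 T,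
      w x t - (∫ y, u y t * ρ (x - y)) - (M / 2 * Real.exp (3 * K * t) + κ) ≤ 0 := by
  have hli : ∀ t ∈ Icc 0 T, LocallyIntegrable fun x => u x t :=
    fun t ht => hu.locallyIntegrable t ht.1
  have hubae : ∀ t ∈ Icc 0 T, ∀ᵐ x, -ℓ ≤ u x t ∧ u x t ≤ L := by
    intro t ht
    rcases ht.1.eq_or_lt with h | h
    · rw [← h]; exact hub₀
    · exact Eventually.of_forall fun x => hub x t ⟨h, ht.2⟩
  have hAbs : ∀ a : ℝ, -ℓ ≤ a → a ≤ L → |a| ≤ A := fun a h1 h2 =>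
    abs_le.2 ⟨by linarith [le_abs_self ℓ], by linarith [le_abs_self L]⟩
  have hρx : ∀ x, ContDiff ℝ ∞ fun y => ρ (x - y) := fun x =>
    hρ.comp (contDiff_const.sub contDiff_id)
  have hUlow : ∀ x, ∀ t ∈ Icc 0 T, -ℓ ≤ ∫ y, u y t * ρ (x - y) := fun x t ht =>
    le_mollify (hli t ht) hρ.continuous hρc hρ0 hρ1 ((hubae t ht).mono fun y hy _ => hy.1)
  refine nonpos_of_subsolution (B := L + ℓ) ?_ ?_ ?_ ?_
  · refine (hw.continuousOn.sub (continuousOn_mollify (A := A) hli ?_ hρ.continuous hρc ?_)).sub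
      (Continuous.continuousOn (by fun_prop))
    · exact fun t ht => (hubae t ht).mono fun x hx => hAbs _ hx.1 hx.2
    · exact fun x => (hu.continuous_distrib _ (hρx x) (hasCompactSupport_const_sub hρc x)).mono
        Icc_subset_Ici_self
  · intro x t ht
    have h1 := hw.le x t ht
    have h2 := hUlow x t ht
    have h3 : 0 ≤ M / 2 * Real.exp (3 * K * t) := by positivity
    linarith
  · intro x
    have h0 : (0 : ℝ) ∈ Icc 0 T := ⟨le_rfl, hT⟩
    · have h1 : max (w x 0) (-ℓ) - κ / 2 ≤ ∫ y, u y 0 * ρ (x - y) := by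
        refine le_mollify (hli 0 h0) hρ.continuous hρc hρ0 hρ1 ?_
        filter_upwards [hub₀, hw₀] with y h1 h2 hy
        have h3 := (abs_le.1 (hη 0 h0 x y (hρη _ hy))).2
        have h4 : max (w y 0) (-ℓ) ≤ u y 0 := max_le h2 h1.1
        linarith
      have h2 := le_max_left (w x 0) (-ℓ)
      have h3 : 0 ≤ M / 2 * Real.exp (3 * K * 0) := by positivity
      linarith
  · intro x t ht hpos
    have htI : t ∈ Icc 0 T := ⟨ht.1.le, ht.2⟩
    set U := ∫ y, u y t * ρ (x - y) with hU
    have hexp : 0 ≤ M * Real.exp (3 * K * t) := by positivity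
    -- The mollification is at least `-ℓ`, so where the difference is positive the barrier lies in
    -- the range in which it is a subsolution.
    have hwl : -ℓ < w x t := by linarith [hUlow x t htI]
    obtain ⟨w', q, hw', hq, hle⟩ := hw.subsolution x t ht hwl
    have hUd := hu.hasDerivAt_integral hcont (hρx x) (hasCompactSupport_const_sub hρc x) ht.1
    set r : Fin (n + 1) → ℝ := fun i => ∫ y, u y t * dirDeriv (EuclideanSpace.single i 1)
      (dirDeriv (EuclideanSpace.single i 1) ρ) (x - y) with hr
    have hUr : ∀ i, HasSecondLineDeriv (fun x => ∫ y, u y t * ρ (x - y))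
        (EuclideanSpace.single i 1) x (r i) := fun i =>
      hasSecondLineDeriv_mollify (hli t htI) hρ hρc _ x
    have hut : Continuous fun y => u y t :=
      continuous_slice hcont ht.1
    have hft : LocallyIntegrable fun y => 1 / ε ^ 2 * nonlinearity (u y t) :=
      (continuous_const.mul (continuous_nonlinearity.comp hut)).locallyIntegrable
    have hfi := integrable_mul_const_sub hft hρ.continuous hρc x
    have hlap : ∫ y, (u y t * Laplacian.laplacian (fun y => ρ (x - y)) y -
        1 / ε ^ 2 * nonlinearity (u y t) * ρ (x - y)) =
        ∑ i, r i - ∫ y, 1 / ε ^ 2 * nonlinearity (u y t) * ρ (x - y) := by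
      have hri : ∀ i ∈ Finset.univ, Integrable fun y => u y t *
          dirDeriv (EuclideanSpace.single i 1) (dirDeriv (EuclideanSpace.single i 1) ρ) (x - y) :=
        fun i _ => integrable_mul_const_sub (hli t htI)
          (contDiff_dirDeriv (contDiff_dirDeriv hρ _) _).continuous
          (hasCompactSupport_dirDeriv (hasCompactSupport_dirDeriv hρc _) _) x
      have e : ∀ y, u y t * Laplacian.laplacian (fun y => ρ (x - y)) y = ∑ i, u y t *
          dirDeriv (EuclideanSpace.single i 1) (dirDeriv (EuclideanSpace.single i 1) ρ) (x - y) := by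
        intro y
        rw [laplacian_eq_sum_dirDeriv (hρx x), Finset.mul_sum]
        simp only [dirDeriv_dirDeriv_const_sub hρ]
      simp only [e]
      rw [integral_sub (integrable_finsetSum _ hri) hfi, integral_finsetSum _ hri]
    rw [hlap] at hUd
    refine ⟨w' - (∑ i, r i - ∫ y, 1 / ε ^ 2 * nonlinearity (u y t) * ρ (x - y)) -
      M / 2 * (Real.exp (3 * K * t) * (3 * K)), fun i => q i - r i, ?_, ?_, ?_⟩
    · refine (hw'.sub hUd).sub ?_
      have h1 : HasDerivAt (fun t : ℝ => 3 * K * t) (3 * K) t := by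
        simpa using (hasDerivAt_id t).const_mul (3 * K)
      exact (h1.exp.const_mul (M / 2)).add_const κ
    · intro i
      exact ((hq i).sub (hUr i)).sub_const _
    -- The shifted reaction `g(s) = Ks - f(s)/ε²` is increasing with Lipschitz constant `2K`.
    -- Passing from `w x t` to the truncated `w y t` costs at most `2K · κ/2`; passing on to `u y t`
    -- costs at most `2K` times the assumed bound on `w - u`.
    · have hreact : K * w x t - 1 / ε ^ 2 * nonlinearity (w x t) - K * κ -
          2 * K * (M * Real.exp (3 * K * t)) ≤
          ∫ y, (K * u y t - 1 / ε ^ 2 * nonlinearity (u y t)) * ρ (x - y) := by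
        refine le_mollify (((hli t htI).smul K).sub hft) hρ.continuous hρc hρ0 hρ1
          (Eventually.of_forall fun y hy => ?_)
        have h3 := (abs_le.1 (hη t htI x y (hρη _ hy))).2
        have hmx : max (w x t) (-ℓ) = w x t := max_eq_left hwl.le
        rw [hmx] at h3
        set v := max (w y t) (-ℓ) with hv
        have hvA : |v| ≤ A := hAbs _ (le_max_right _ _) (max_le (hw.le y t htI) hℓL)
        have hwA : |w x t| ≤ A := hAbs _ hwl.le (hw.le x t htI)
        have huA : |u y t| ≤ A := hAbs _ (hub y t ht).1 (hub y t ht).2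
        have h4 : K * w x t - 1 / ε ^ 2 * nonlinearity (w x t) - K * κ ≤
            K * v - 1 / ε ^ 2 * nonlinearity v := by
          have hKκ : 0 ≤ K * κ := by positivity
          rcases le_total (w x t) v with h | h
          · have := (hmono _ _ hwA hvA h).1
            linarith
          · have := (hmono _ _ hvA hwA h).2
            have h5 : 2 * K * (w x t - v) ≤ 2 * K * (κ / 2) :=
              mul_le_mul_of_nonneg_left h3 (by positivity)
            linarith
        have h6 : v - u y t ≤ M * Real.exp (3 * K * t) := by
          rw [hv]
          have h7 := hwM y t ht
          have h8 := (hub y t ht).1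
          have : max (w y t) (-ℓ) ≤ u y t + M * Real.exp (3 * K * t) :=
            max_le (by linarith) (by linarith)
          linarith
        have h9 : K * v - 1 / ε ^ 2 * nonlinearity v - 2 * K * (M * Real.exp (3 * K * t)) ≤
            K * u y t - 1 / ε ^ 2 * nonlinearity (u y t) := by
          have hKM : 0 ≤ K * (M * Real.exp (3 * K * t)) := by positivity
          rcases le_total v (u y t) with h | h
          · have := (hmono _ _ hvA huA h).1
            linarith
          · have := (hmono _ _ huA hvA h).2
            have h5 : 2 * K * (v - u y t) ≤ 2 * K * (M * Real.exp (3 * K * t)) :=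
              mul_le_mul_of_nonneg_left h6 (by positivity)
            linarith
        refine le_trans ?_ h9
        linarith
      have hsplit : ∫ y, (K * u y t - 1 / ε ^ 2 * nonlinearity (u y t)) * ρ (x - y) =
          K * U - ∫ y, 1 / ε ^ 2 * nonlinearity (u y t) * ρ (x - y) := by
        have hui := integrable_mul_const_sub (hli t htI) hρ.continuous hρc x
        rw [hU, ← integral_const_mul, ← integral_sub (hui.const_mul K) hfi]
        congr 1
        funext y
        ring
      rw [hsplit] at hreact
      -- Positivity of the difference turns `-K(w - U)` into a gain of `K(M/2)exp(3Kt) + Kκ`. What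
      -- remains is `(2K - K/2)M exp(3Kt)`, exactly the time derivative of `(M/2)exp(3Kt)`; this
      -- fixes the rate `3K`.
      have hKpos := mul_pos hK hpos
      rw [Finset.sum_sub_distrib]
      linarith

/-- Comparison principle: a barrier that lies below the initial datum lies below the solution. -/
theorem IsBarrier.le_solution (hε : 0 < ε) (hu : IsSolution ε u₀ u)
    (hcont : ContinuousOn (fun p : EuclideanSpace ℝ (Fin (n + 1)) × ℝ => u p.1 p.2)
      (univ ×ˢ Ioi 0)) {ℓ L T : ℝ} {w : EuclideanSpace ℝ (Fin (n + 1)) → ℝ → ℝ}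
    (hw : IsBarrier ε ℓ L T w)
    (hub : ∀ x, ∀ t ∈ Ioc 0 T, -ℓ ≤ u x t ∧ u x t ≤ L) (hub₀ : ∀ᵐ x, -ℓ ≤ u x 0 ∧ u x 0 ≤ L)
    (hw₀ : ∀ᵐ x, w x 0 ≤ u x 0) : ∀ x, ∀ t ∈ Ioc 0 T, w x t ≤ u x t := by
  obtain ⟨x₀, hx₀⟩ := hub₀.exists
  have hℓL : -ℓ ≤ L := hx₀.1.trans hx₀.2
  obtain ⟨K, hK, hmono⟩ := exists_monotone_shift ε (max |ℓ| |L|) hε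
  -- One pass halves the constant. At a fixed point of positive time the mollification is close to
  -- `u` by continuity, and `κ` is arbitrary.
  have step : ∀ M : ℝ, 0 ≤ M →
      (∀ x, ∀ t ∈ Ioc 0 T, w x t - u x t ≤ M * Real.exp (3 * K * t)) →
      ∀ x, ∀ t ∈ Ioc 0 T, w x t - u x t ≤ M / 2 * Real.exp (3 * K * t) := by
    intro M hM hwM x t ht
    refine le_of_forall_pos_le_add fun κ hκ => ?_
    obtain ⟨η₁, hη₁, hη⟩ := hw.uniform (κ / 2 / 2) (by positivity)
    have hut : Continuous fun y => u y t :=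
      continuous_slice hcont ht.1
    obtain ⟨η₂, hη₂, hη'⟩ := Metric.continuous_iff.1 hut x (κ / 2) (by positivity)
    obtain ⟨ρ, hρ, hρc, hρ0, hρ1, hρη⟩ := exists_mollifier (n + 1) (lt_min hη₁ hη₂)
    have h1 := hw.sub_mollify_le hu hcont (le_max_left _ _) (le_max_right _ _) hℓL hK hmono hub hub₀
      hw₀ (ht.1.le.trans ht.2) hM (half_pos hκ) hη hwM hρ hρc hρ0 hρ1 (fun y hy => (hρη y hy).trans_le (min_le_left _ _))
      x t ⟨ht.1.le, ht.2⟩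
    have h2 : ∫ y, u y t * ρ (x - y) ≤ u x t + κ / 2 := by
      refine mollify_le hut.locallyIntegrable hρ.continuous hρc hρ0 hρ1
        (Eventually.of_forall fun y hy => ?_)
      have h3 := hη' y (by
        rw [dist_comm, dist_eq_norm]
        exact (hρη _ hy).trans_le (min_le_right _ _))
      rw [Real.dist_eq] at h3
      linarith [(abs_lt.1 h3).2]
    linarith
  have hiter : ∀ k : ℕ, ∀ x, ∀ t ∈ Ioc 0 T,
      w x t - u x t ≤ (L + ℓ) * (1 / 2) ^ k * Real.exp (3 * K * t) := by
    intro k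
    induction k with
    | zero =>
      intro x t ht
      have h1 := hw.le x t ⟨ht.1.le, ht.2⟩
      have h2 := (hub x t ht).1
      have h3 : 1 ≤ Real.exp (3 * K * t) := Real.one_le_exp (by have := ht.1; positivity)
      have h4 : 0 ≤ L + ℓ := by linarith
      rw [pow_zero, mul_one]
      nlinarith
    | succ k ih =>
      have h4 : 0 ≤ L + ℓ := by linarith
      intro x t ht
      have := step _ (by positivity) ih x t ht
      rw [pow_succ]
      linarith
  intro x t ht
  have hlim : Tendsto (fun k : ℕ => (L + ℓ) * (1 / 2) ^ k * Real.exp (3 * K * t)) atTop (𝓝 0) := by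
    have := ((tendsto_pow_atTop_nhds_zero_of_lt_one (r := (1 / 2 : ℝ)) (by norm_num)
      (by norm_num)).const_mul (L + ℓ)).mul_const (Real.exp (3 * K * t))
    simpa using this
  have := ge_of_tendsto' hlim fun k => hiter k x t ht
  linarith

/-! ### Explicit barriers -/

variable {n : ℕ} {ε : ℝ} {u₀ : EuclideanSpace ℝ (Fin (n + 1)) → ℝ}
  {u : EuclideanSpace ℝ (Fin (n + 1)) → ℝ → ℝ}

/-- The constant `-1` is a zero of the nonlinearity. With `ℓ` an a priori bound it yields `u ≥ -1`,
which the other barriers, truncated at `-1`, require. -/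
theorem isBarrier_neg_one (ε : ℝ) {ℓ L T : ℝ} (hL : -1 ≤ L) :
    IsBarrier (n := n) ε ℓ L T fun _ _ => -1 where
  continuousOn := continuousOn_const
  le := fun _ _ _ => hL
  uniform := fun κ hκ => ⟨1, one_pos, fun _ _ _ _ _ => by simpa using hκ.le⟩
  subsolution := fun x t _ _ => by
    refine ⟨0, fun _ => 0, hasDerivAt_const _ _, fun i => ⟨fun _ => 0, fun τ => hasDerivAt_const _ _,
      hasDerivAt_const _ _⟩, ?_⟩
    simp [nonlinearity]

/-- A function that is continuous on `ℝⁿ⁺¹ × [0, T]` and at most `-1` off a ball has a uniformly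
continuous truncation at `-1`. -/
theorem uniform_truncation {T R : ℝ} {x₀ : EuclideanSpace ℝ (Fin (n + 1))}
    {w : EuclideanSpace ℝ (Fin (n + 1)) → ℝ → ℝ}
    (hw : ContinuousOn (fun p : EuclideanSpace ℝ (Fin (n + 1)) × ℝ => w p.1 p.2) (univ ×ˢ Icc 0 T))
    (hR : ∀ x, ∀ t ∈ Icc 0 T, R ≤ ‖x - x₀‖ → w x t ≤ -1) (κ : ℝ) (hκ : 0 < κ) :
    ∃ η : ℝ, 0 < η ∧ ∀ t ∈ Icc 0 T, ∀ x y, ‖x - y‖ < η →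
      |max (w x t) (-1) - max (w y t) (-1)| ≤ κ := by
  have huc : UniformContinuousOn
      (fun p : EuclideanSpace ℝ (Fin (n + 1)) × ℝ => max (w p.1 p.2) (-1))
      (Metric.closedBall x₀ (R + 1) ×ˢ Icc 0 T) :=
    ((isCompact_closedBall x₀ (R + 1)).prod isCompact_Icc).uniformContinuousOn_of_continuous
      ((hw.mono (prod_mono (subset_univ _) le_rfl)).sup continuousOn_const)
  obtain ⟨η, hη, h⟩ := Metric.uniformContinuousOn_iff.1 huc κ hκ
  have hfar : ∀ x y : EuclideanSpace ℝ (Fin (n + 1)), R + 1 < ‖x - x₀‖ → ‖x - y‖ < 1 →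
      R ≤ ‖x - x₀‖ ∧ R ≤ ‖y - x₀‖ := by
    intro x y hx hxy
    have := norm_sub_le_norm_sub_add_norm_sub x y x₀
    exact ⟨by linarith, by linarith⟩
  -- Two points less than `1` apart either both lie in the compact ball of radius `R + 1` or both
  -- lie at distance at least `R`, where the truncation is constant.
  refine ⟨min η 1, lt_min hη one_pos, fun t ht x y hxy => ?_⟩
  have h1 : ‖x - y‖ < 1 := hxy.trans_le (min_le_right _ _)
  have hout : R ≤ ‖x - x₀‖ ∧ R ≤ ‖y - x₀‖ → |max (w x t) (-1) - max (w y t) (-1)| ≤ κ := by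
    intro ⟨hx, hy⟩
    rw [max_eq_right (hR x t ht hx), max_eq_right (hR y t ht hy)]
    simpa using hκ.le
  by_cases hx : ‖x - x₀‖ ≤ R + 1
  · by_cases hy : ‖y - x₀‖ ≤ R + 1
    · have := h (x, t) ⟨by simpa [dist_eq_norm] using hx, ht⟩ (y, t)
        ⟨by simpa [dist_eq_norm] using hy, ht⟩ (by
          rw [Prod.dist_eq, dist_self, dist_eq_norm]
          exact max_lt (hxy.trans_le (min_le_left _ _)) hη)
      rw [Real.dist_eq] at this
      exact this.le
    · exact hout (hfar y x (not_le.1 hy) (by rwa [norm_sub_rev])).symm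
  · exact hout (hfar x y (not_le.1 hx) h1)

/-- Gaussian barrier, effective for `T` at most of order `ε²`. -/
theorem isBarrier_gaussian (hε : 0 < ε) {R T L : ℝ} (hR : 0 < R) (hT : 0 < T) (hL : 1 ≤ L)
    (x₀ : EuclideanSpace ℝ (Fin (n + 1))) :
    (∀ x, ∀ t ∈ Icc 0 T, R ≤ ‖x - x₀‖ → 1 - 2 * Real.exp (t / (2 * ε ^ 2) +
      ‖x - x₀‖ ^ 2 / (4 * (5 / 4 * T - t)) - R ^ 2 / (5 * T) + 2 * (n + 1) * t / T) ≤ -1) ∧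
    IsBarrier ε 1 L T fun x t => 1 - 2 * Real.exp (t / (2 * ε ^ 2) +
      ‖x - x₀‖ ^ 2 / (4 * (5 / 4 * T - t)) - R ^ 2 / (5 * T) + 2 * (n + 1) * t / T) := by
  -- The Gaussian blows up only at time `5T/4`. On `[0, T]` the denominator `4(5T/4 - t)` lies
  -- between `T` and `5T`: the lower end bounds the Laplacian, the upper end makes `R²/(5T)` the
  -- right offset at distance `R`.
  have hσ : ∀ t ∈ Icc 0 T, T / 4 ≤ 5 / 4 * T - t := fun t ht => by linarith [ht.2]
  have hcont : ContinuousOn (fun p : EuclideanSpace ℝ (Fin (n + 1)) × ℝ =>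
      1 - 2 * Real.exp (p.2 / (2 * ε ^ 2) + ‖p.1 - x₀‖ ^ 2 / (4 * (5 / 4 * T - p.2)) -
        R ^ 2 / (5 * T) + 2 * (n + 1) * p.2 / T)) (univ ×ˢ Icc 0 T) := by
    have h1 : ContinuousOn (fun p : EuclideanSpace ℝ (Fin (n + 1)) × ℝ =>
        ‖p.1 - x₀‖ ^ 2 / (4 * (5 / 4 * T - p.2))) (univ ×ˢ Icc 0 T) := by
      refine ContinuousOn.div (by fun_prop) (by fun_prop) fun p hp => ?_
      have := hσ p.2 hp.2
      exact (by linarith : 0 < 4 * (5 / 4 * T - p.2)).ne'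
    fun_prop
  have hfar : ∀ x, ∀ t ∈ Icc 0 T, R ≤ ‖x - x₀‖ → 1 - 2 * Real.exp (t / (2 * ε ^ 2) +
      ‖x - x₀‖ ^ 2 / (4 * (5 / 4 * T - t)) - R ^ 2 / (5 * T) + 2 * (n + 1) * t / T) ≤ -1 := by
    intro x t ht hx
    have h0 := hσ t ht
    have ht0 := ht.1
    have h1 : R ^ 2 / (5 * T) ≤ ‖x - x₀‖ ^ 2 / (4 * (5 / 4 * T - t)) :=
      div_le_div₀ (by positivity) (pow_le_pow_left₀ hR.le hx 2) (by linarith) (by linarith)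
    have h2 : 0 ≤ t / (2 * ε ^ 2) := by positivity
    have h3 : 0 ≤ 2 * (n + 1) * t / T := by positivity
    have := Real.one_le_exp (x := t / (2 * ε ^ 2) +
      ‖x - x₀‖ ^ 2 / (4 * (5 / 4 * T - t)) - R ^ 2 / (5 * T) + 2 * (n + 1) * t / T) (by linarith)
    linarith
  refine ⟨hfar, hcont, fun x t _ => ?_, uniform_truncation hcont hfar, fun x t ht _ => ?_⟩
  · have := Real.exp_pos (t / (2 * ε ^ 2) +
      ‖x - x₀‖ ^ 2 / (4 * (5 / 4 * T - t)) - R ^ 2 / (5 * T) + 2 * (n + 1) * t / T)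
    linarith
  · have hs := hσ t ⟨ht.1.le, ht.2⟩
    set σ := 5 / 4 * T - t with hσd
    have hσ0 : 0 < σ := by linarith
    set h := 2 * Real.exp (t / (2 * ε ^ 2) + ‖x - x₀‖ ^ 2 / (4 * σ) - R ^ 2 / (5 * T) +
      2 * (n + 1) * t / T) with hh
    have hh0 : 0 < h := by positivity
    set φ : ℝ → ℝ := fun s => 1 - 2 * Real.exp (t / (2 * ε ^ 2) + s / (4 * σ) - R ^ 2 / (5 * T) +
      2 * (n + 1) * t / T) with hφ
    have hE : ∀ s : ℝ, HasDerivAt (fun s : ℝ => Real.exp (t / (2 * ε ^ 2) + s / (4 * σ) -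
        R ^ 2 / (5 * T) + 2 * (n + 1) * t / T)) (Real.exp (t / (2 * ε ^ 2) + s / (4 * σ) -
        R ^ 2 / (5 * T) + 2 * (n + 1) * t / T) * (1 / (4 * σ))) s := by
      intro s
      exact (((((hasDerivAt_id s).div_const (4 * σ)).const_add (t / (2 * ε ^ 2))).sub_const
        (R ^ 2 / (5 * T))).add_const (2 * (n + 1) * t / T)).exp
    have hrad := hasSecondLineDeriv_radial (φ := φ) (φ' := fun s => -(2 * (Real.exp
        (t / (2 * ε ^ 2) + s / (4 * σ) - R ^ 2 / (5 * T) + 2 * (n + 1) * t / T) * (1 / (4 * σ)))))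
      (fun s => ((hE s).const_mul 2).const_sub 1) x₀ x
      ((((hE (‖x - x₀‖ ^ 2)).mul_const (1 / (4 * σ))).const_mul 2).neg)
    refine ⟨-(h * (1 / (2 * ε ^ 2) + ‖x - x₀‖ ^ 2 / (4 * σ ^ 2) + 2 * (n + 1) / T)), _, ?_, hrad, ?_⟩
    · have h1 : HasDerivAt (fun t : ℝ => t / (2 * ε ^ 2)) (1 / (2 * ε ^ 2)) t :=
        (hasDerivAt_id t).div_const _
      have h2 : HasDerivAt (fun t : ℝ => 4 * (5 / 4 * T - t)) (-4) t := by
        simpa using ((hasDerivAt_id t).const_sub (5 / 4 * T)).const_mul 4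
      have h3 := (hasDerivAt_const t (‖x - x₀‖ ^ 2)).div h2 (by rw [← hσd]; positivity)
      have h4 : HasDerivAt (fun t : ℝ => 2 * ((n : ℝ) + 1) * t / T) (2 * (n + 1) * 1 / T) t :=
        ((hasDerivAt_id t).const_mul _).div_const _
      have h5 := ((((h1.add h3).sub_const (R ^ 2 / (5 * T))).add h4).exp.const_mul 2).const_sub 1
      refine h5.congr_deriv ?_
      simp only [Pi.add_apply, Pi.div_apply]
      rw [← hσd, hh]
      field_simp
      ring
    · rw [sum_radial]
      have hlow : 2 * ((n : ℝ) + 1) * (1 / (4 * σ)) ≤ 2 * (n + 1) / T := by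
        rw [mul_one_div, div_le_div_iff₀ (by positivity) hT]
        have : (0 : ℝ) ≤ n := Nat.cast_nonneg n
        nlinarith
      -- The rate `1/(2ε²)` is chosen to complete a square: `2(1 - h)(2 - h) + 1/2 = 2(h - 3/2)²`.
      have hf : -(1 / (2 * ε ^ 2)) * h ≤ - (1 / ε ^ 2 * nonlinearity (1 - h)) := by
        have e : - (1 / ε ^ 2 * nonlinearity (1 - h)) - -(1 / (2 * ε ^ 2)) * h =
            2 * h * (1 / ε ^ 2) * (h - 3 / 2) ^ 2 := by
          unfold nonlinearity; field_simp; ring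
        have : 0 ≤ 2 * h * (1 / ε ^ 2) * (h - 3 / 2) ^ 2 := by positivity
        linarith
      have e2 : 4 * -(2 * (Real.exp (t / (2 * ε ^ 2) + ‖x - x₀‖ ^ 2 / (4 * σ) - R ^ 2 / (5 * T) +
          2 * (n + 1) * t / T) * (1 / (4 * σ)) * (1 / (4 * σ)))) * ‖x - x₀‖ ^ 2 +
          2 * ((n + 1 : ℕ) : ℝ) * -(2 * (Real.exp (t / (2 * ε ^ 2) + ‖x - x₀‖ ^ 2 / (4 * σ) -
          R ^ 2 / (5 * T) + 2 * (n + 1) * t / T) * (1 / (4 * σ)))) =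
          -(h * (‖x - x₀‖ ^ 2 / (4 * σ ^ 2))) - h * (2 * ((n : ℝ) + 1) * (1 / (4 * σ))) := by
        rw [hh]; push_cast; field_simp; ring
      rw [e2]
      have h6 := mul_le_mul_of_nonneg_left hlow hh0.le
      rw [show ∀ a b c : ℝ, -(h * (a + b + c)) = -a * h - h * b - h * c by intros; ring]
      linarith

theorem tanh_eq_one_sub (y : ℝ) : Real.tanh y = 1 - 2 / (1 + Real.exp (2 * y)) := by
  rw [Real.tanh_eq]
  have h1 : Real.exp (2 * y) = Real.exp y * Real.exp y := by rw [← Real.exp_add]; ring_nf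
  have h2 : Real.exp (-y) = (Real.exp y)⁻¹ := Real.exp_neg y
  have := Real.exp_pos y
  rw [h1, h2]
  field_simp
  ring

theorem hasDerivAt_tanh (y : ℝ) : HasDerivAt Real.tanh (1 - Real.tanh y ^ 2) y := by
  have h := (Real.hasDerivAt_sinh y).div (Real.hasDerivAt_cosh y) (Real.cosh_pos y).ne'
  have e : Real.tanh = fun y => Real.sinh y / Real.cosh y :=
    funext fun y => Real.tanh_eq_sinh_div_cosh y
  rw [e]
  refine h.congr_deriv ?_
  have := (Real.cosh_pos y).ne'
  simp only
  field_simp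

theorem tanh_le_exp (y : ℝ) : Real.tanh y ≤ -1 + 2 * Real.exp (2 * y) := by
  rw [tanh_eq_one_sub]
  have h := Real.exp_pos (2 * y)
  have : 1 - Real.exp (2 * y) ≤ 1 / (1 + Real.exp (2 * y)) := by
    rw [le_div_iff₀ (by positivity)]
    nlinarith
  rw [show 2 / (1 + Real.exp (2 * y)) = 2 * (1 / (1 + Real.exp (2 * y))) by ring]
  linarith

/-- The pointwise inequality that makes the shrinking sphere barrier a subsolution: `q` is the
profile, `δ` the downward shift, `r` the radius of the sphere and `s` the squared distance to its
centre. -/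
theorem sphere_inequality {ε δ r s q N : ℝ} (hε : 0 < ε) (hδ : 0 ≤ δ) (hδ' : δ ≤ 2 / 3) (hr : 0 < r)
    (hs : 0 ≤ s) (hN : 0 ≤ N) (hq : q ^ 2 ≤ 1) (hsign : 0 ≤ q * (r ^ 2 - s))
    (hδr : 8 * r * δ ≤ N * ε) :
    (1 - q ^ 2) * (-(3 * N / (2 * r * ε)) * (1 + s / r ^ 2)) ≤
      4 * (-(2 * q * (1 - q ^ 2)) * (1 / (2 * r * ε)) ^ 2) * s +
        2 * N * (-((1 - q ^ 2) * (1 / (2 * r * ε)))) - 1 / ε ^ 2 * nonlinearity (q - δ) := by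
  have hq1 : |q| ≤ 1 := abs_le_of_sq_le_sq' (by simpa using hq) zero_le_one |> abs_le.2
  -- Lowering the profile by `δ` costs at most `4δ(1 - q²)`. This carries the factor `1 - q²` common
  -- to all other terms, which can then be divided out.
  have hf : nonlinearity (q - δ) ≤ (1 - q ^ 2) * (4 * δ - 2 * q) := by
    have e : (1 - q ^ 2) * (4 * δ - 2 * q) - nonlinearity (q - δ) =
        2 * δ * (1 + q ^ 2 + δ ^ 2 - 3 * q * δ) := by
      unfold nonlinearity; ring
    have h1 : q * δ ≤ |q| * (2 / 3) :=
      (mul_le_mul_of_nonneg_right (le_abs_self q) hδ).trans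
        (mul_le_mul_of_nonneg_left hδ' (abs_nonneg q))
    have h2 : 0 ≤ 1 + q ^ 2 + δ ^ 2 - 3 * q * δ := by
      have h3 : 0 ≤ (1 - |q|) ^ 2 := sq_nonneg _
      have h4 : |q| ^ 2 = q ^ 2 := sq_abs q
      nlinarith [sq_nonneg δ]
    have := mul_nonneg (mul_nonneg zero_le_two hδ) h2
    linarith
  have hf' : 1 / ε ^ 2 * nonlinearity (q - δ) ≤ 1 / ε ^ 2 * ((1 - q ^ 2) * (4 * δ - 2 * q)) :=
    mul_le_mul_of_nonneg_left hf (by positivity)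
  have hmain : (1 - q ^ 2) * (-(3 * N / (2 * r * ε)) * (1 + s / r ^ 2)) ≤
      (1 - q ^ 2) * (-(2 * q * s / (r ^ 2 * ε ^ 2)) - N / (r * ε) - (4 * δ - 2 * q) / ε ^ 2) := by
    refine mul_le_mul_of_nonneg_left ?_ (by linarith)
    -- Three nonnegative surpluses: the profile gradient differs from unit slope with a favourable
    -- sign on both sides of the sphere; the sphere shrinks faster where `s` is large; and the
    -- excess speed `N/(2rε)` absorbs `4δ/ε²`.
    have e : -(2 * q * s / (r ^ 2 * ε ^ 2)) - N / (r * ε) - (4 * δ - 2 * q) / ε ^ 2 -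
        -(3 * N / (2 * r * ε)) * (1 + s / r ^ 2) =
        2 * (q * (r ^ 2 - s)) / (r ^ 2 * ε ^ 2) + 3 * N * s / (2 * r ^ 3 * ε) +
        (N * ε - 8 * r * δ) / (2 * r * ε ^ 2) := by
      field_simp; ring
    have h1 : 0 ≤ 2 * (q * (r ^ 2 - s)) / (r ^ 2 * ε ^ 2) := by positivity
    have h2 : 0 ≤ 3 * N * s / (2 * r ^ 3 * ε) := by positivity
    have h3 : 0 ≤ (N * ε - 8 * r * δ) / (2 * r * ε ^ 2) :=
      div_nonneg (by linarith) (by positivity)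
    linarith
  have e2 : 4 * (-(2 * q * (1 - q ^ 2)) * (1 / (2 * r * ε)) ^ 2) * s +
      2 * N * (-((1 - q ^ 2) * (1 / (2 * r * ε)))) -
      1 / ε ^ 2 * ((1 - q ^ 2) * (4 * δ - 2 * q)) =
      (1 - q ^ 2) * (-(2 * q * s / (r ^ 2 * ε ^ 2)) - N / (r * ε) - (4 * δ - 2 * q) / ε ^ 2) := by
    field_simp; ring
  linarith

theorem tanh_nonneg {y : ℝ} (hy : 0 ≤ y) : 0 ≤ Real.tanh y := by
  rw [Real.tanh_eq_sinh_div_cosh]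
  exact div_nonneg (Real.sinh_nonneg_iff.2 hy) (Real.cosh_pos y).le

theorem continuous_tanh : Continuous Real.tanh :=
  continuous_iff_continuousAt.2 fun y => (hasDerivAt_tanh y).continuousAt

/-- Shrinking sphere barrier, effective for `T` at least of order `ε²`. -/
theorem isBarrier_sphere {n : ℕ} {ε R T δ L : ℝ} (hε : 0 < ε) (hR : 0 < R)
    (hRT : 6 * ((n : ℝ) + 1) * T < R ^ 2 / 4) (hδ : δ = 2 * Real.exp (-(3 * R / (2 * ε))))
    (hδ' : δ ≤ 2 / 3) (hδR : 4 * R * δ ≤ ((n : ℝ) + 1) * ε) (hL : 1 ≤ L)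
    (x₀ : EuclideanSpace ℝ (Fin (n + 1))) :
    (∀ x, ∀ t ∈ Icc 0 T, R ≤ ‖x - x₀‖ → Real.tanh ((R ^ 2 / 4 - 6 * (n + 1) * t - ‖x - x₀‖ ^ 2) /
      (2 * √(R ^ 2 / 4 - 6 * (n + 1) * t) * ε)) - δ ≤ -1) ∧
    IsBarrier ε 1 L T fun x t => Real.tanh ((R ^ 2 / 4 - 6 * (n + 1) * t - ‖x - x₀‖ ^ 2) /
      (2 * √(R ^ 2 / 4 - 6 * (n + 1) * t) * ε)) - δ := by
  have hn : (0 : ℝ) < n + 1 := by positivity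
  have hδ0 : 0 < δ := by rw [hδ]; positivity
  have hpos : ∀ t, t ≤ T → 0 < R ^ 2 / 4 - 6 * ((n : ℝ) + 1) * t := fun t ht => by
    have : 6 * ((n : ℝ) + 1) * t ≤ 6 * (n + 1) * T := mul_le_mul_of_nonneg_left ht (by positivity)
    linarith
  have hrR : ∀ t, 0 ≤ t → √(R ^ 2 / 4 - 6 * ((n : ℝ) + 1) * t) ≤ R / 2 := fun t ht => by
    rw [Real.sqrt_le_left (by positivity)]
    have : 0 ≤ 6 * ((n : ℝ) + 1) * t := by positivity
    nlinarith
  have hcont : ContinuousOn (fun p : EuclideanSpace ℝ (Fin (n + 1)) × ℝ =>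
      Real.tanh ((R ^ 2 / 4 - 6 * (n + 1) * p.2 - ‖p.1 - x₀‖ ^ 2) /
      (2 * √(R ^ 2 / 4 - 6 * (n + 1) * p.2) * ε)) - δ) (univ ×ˢ Icc 0 T) := by
    refine (continuous_tanh.comp_continuousOn (ContinuousOn.div (by fun_prop) (by fun_prop)
      fun p hp => ?_)).sub continuousOn_const
    have := Real.sqrt_pos.2 (hpos p.2 hp.2.2)
    positivity
  have hfar : ∀ x, ∀ t ∈ Icc 0 T, R ≤ ‖x - x₀‖ →
      Real.tanh ((R ^ 2 / 4 - 6 * (n + 1) * t - ‖x - x₀‖ ^ 2) /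
      (2 * √(R ^ 2 / 4 - 6 * (n + 1) * t) * ε)) - δ ≤ -1 := by
    intro x t ht hx
    have hr := hrR t ht.1
    have hp := hpos t ht.2
    have hr0 := Real.sqrt_pos.2 hp
    have hr2 := Real.sq_sqrt hp.le
    set r := √(R ^ 2 / 4 - 6 * (n + 1) * t)
    have hx2 : R ^ 2 ≤ ‖x - x₀‖ ^ 2 := pow_le_pow_left₀ hR.le hx 2
    -- From `r ≤ R/2` one gets `r² - R² ≤ -(3/2)Rr`, that is `(r + 2R)(r - R/2) ≤ 0`. The resulting
    -- tail of `tanh` is at most `-1 + δ`, which dictates the value of `δ`.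
    have harg : (R ^ 2 / 4 - 6 * (n + 1) * t - ‖x - x₀‖ ^ 2) / (2 * r * ε) ≤
        -(3 * R / (4 * ε)) := by
      rw [div_le_iff₀ (by positivity), ← hr2]
      have e : -(3 * R / (4 * ε)) * (2 * r * ε) = -(3 / 2) * R * r := by field_simp; ring
      rw [e]
      nlinarith
    have h1 := tanh_le_exp ((R ^ 2 / 4 - 6 * (n + 1) * t - ‖x - x₀‖ ^ 2) / (2 * r * ε))
    have h2 : Real.exp (2 * ((R ^ 2 / 4 - 6 * (n + 1) * t - ‖x - x₀‖ ^ 2) / (2 * r * ε))) ≤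
        Real.exp (-(3 * R / (2 * ε))) := by
      refine Real.exp_le_exp.2 ?_
      have e : -(3 * R / (2 * ε)) = 2 * -(3 * R / (4 * ε)) := by field_simp; ring
      rw [e]
      linarith
    rw [hδ]
    linarith
  refine ⟨hfar, hcont, fun x t _ => ?_, uniform_truncation hcont hfar, fun x t ht _ => ?_⟩
  · have := Real.tanh_lt_one ((R ^ 2 / 4 - 6 * (n + 1) * t - ‖x - x₀‖ ^ 2) /
      (2 * √(R ^ 2 / 4 - 6 * (n + 1) * t) * ε))
    linarith
  · have hr := hrR t ht.1.le
    have hp := hpos t ht.2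
    have hr0 := Real.sqrt_pos.2 hp
    have hr2 := Real.sq_sqrt hp.le
    set r := √(R ^ 2 / 4 - 6 * (n + 1) * t) with hrdef
    set ζ : ℝ → ℝ := fun s => (R ^ 2 / 4 - 6 * (n + 1) * t - s) / (2 * r * ε) with hζ
    set s := ‖x - x₀‖ ^ 2 with hs
    set q := Real.tanh (ζ s) with hq
    have hζd : ∀ s, HasDerivAt ζ (-(1 / (2 * r * ε))) s := fun s => by
      have := ((hasDerivAt_id s).const_sub (R ^ 2 / 4 - 6 * (n + 1) * t)).div_const (2 * r * ε)
      exact this.congr_deriv (neg_div _ _)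
    have hT : ∀ s, HasDerivAt (fun s => Real.tanh (ζ s))
        ((1 - Real.tanh (ζ s) ^ 2) * -(1 / (2 * r * ε))) s := fun s =>
      (hasDerivAt_tanh (ζ s)).comp s (hζd s)
    have hrad := hasSecondLineDeriv_radial (φ := fun s => Real.tanh (ζ s) - δ)
      (φ' := fun s => (1 - Real.tanh (ζ s) ^ 2) * -(1 / (2 * r * ε)))
      (fun s => (hT s).sub_const δ) x₀ x ((((hT s).pow 2).const_sub 1).mul_const _)
    refine ⟨(1 - q ^ 2) * (-(3 * ((n : ℝ) + 1) / (2 * r * ε)) * (1 + s / r ^ 2)), _, ?_, hrad, ?_⟩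
    · have h1 : HasDerivAt (fun t : ℝ => R ^ 2 / 4 - 6 * ((n : ℝ) + 1) * t) (-(6 * ((n : ℝ) + 1))) t := by
        simpa using ((hasDerivAt_id t).const_mul (6 * ((n : ℝ) + 1))).const_sub (R ^ 2 / 4)
      have h2 := h1.sqrt hp.ne'
      have h3 := (h1.sub_const s).div ((h2.const_mul 2).mul_const ε)
        (by rw [← hrdef]; positivity)
      have h4 := ((hasDerivAt_tanh _).comp t h3).sub_const δ
      refine h4.congr_deriv ?_
      simp only [Pi.div_apply]
      rw [← hrdef]
      have e0 : Real.tanh ((R ^ 2 / 4 - 6 * (n + 1) * t - s) / (2 * r * ε)) = q := rfl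
      rw [e0, ← hr2]
      congr 1
      field_simp
      ring
    · rw [sum_radial, ← hs]
      have hq2 : q ^ 2 ≤ 1 := (Real.tanh_sq_lt_one _).le
      have hsign : 0 ≤ q * (r ^ 2 - s) := by
        have hden : 0 < 2 * r * ε := by positivity
        rcases le_total s (r ^ 2) with h | h
        · refine mul_nonneg (tanh_nonneg (div_nonneg ?_ hden.le)) (by linarith)
          rw [← hr2]; linarith
        · refine mul_nonneg_of_nonpos_of_nonpos ?_ (by linarith)
          have h1 : 0 ≤ -ζ s := by
            rw [hζ, ← neg_div]
            refine div_nonneg ?_ hden.le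
            rw [← hr2]; linarith
          have h2 := tanh_nonneg h1
          rw [Real.tanh_neg] at h2
          linarith
      have hkey := sphere_inequality (N := (n : ℝ) + 1) hε hδ0.le hδ' hr0 (by positivity) hn.le hq2
        hsign (by nlinarith)
      refine hkey.trans (le_of_eq ?_)
      push_cast
      ring

/-! ### Lower bounds for solutions at the centre of a ball -/

variable {n : ℕ} {ε : ℝ} {u₀ : EuclideanSpace ℝ (Fin (n + 1)) → ℝ}
  {u : EuclideanSpace ℝ (Fin (n + 1)) → ℝ → ℝ}

theorem nonlinearity_neg (s : ℝ) : nonlinearity (-s) = -nonlinearity s := by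
  unfold nonlinearity; ring

/-- Oddness of the nonlinearity; this reduces the upper bound outside `Ω` to the lower bound inside.
-/
theorem IsSolution.neg (hu : IsSolution ε u₀ u) :
    IsSolution ε (fun x => -u₀ x) fun x t => -u x t where
  memLp_top := fun T hT => (hu.memLp_top T hT).neg
  locallyIntegrable := fun t ht => (hu.locallyIntegrable t ht).neg
  continuous_distrib := fun ψ hψ hψc => by
    simp only [neg_mul, integral_neg]
    exact (hu.continuous_distrib ψ hψ hψc).neg
  initial := hu.initial.mono fun x hx => congrArg Neg.neg hx
  equation := fun φ hφ hφc hφt => by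
    simp only [nonlinearity_neg, neg_mul, mul_neg, integral_neg]
    exact congrArg Neg.neg (hu.equation φ hφ hφc hφt)

/-- Solutions with initial datum between `-1` and `1` stay above `-1` and are bounded. -/
theorem IsSolution.exists_bounds (hε : 0 < ε) (hu : IsSolution ε u₀ u)
    (hcont : ContinuousOn (fun p : EuclideanSpace ℝ (Fin (n + 1)) × ℝ => u p.1 p.2)
      (univ ×ˢ Ioi 0)) (h₀ : ∀ x, |u₀ x| ≤ 1) {T : ℝ} (hT : 0 < T) :
    ∃ L : ℝ, 1 ≤ L ∧ (∀ x, ∀ t ∈ Ioc 0 T, -1 ≤ u x t ∧ u x t ≤ L) ∧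
      ∀ᵐ x, -1 ≤ u x 0 ∧ u x 0 ≤ L := by
  obtain ⟨L, hL⟩ := hu.exists_abs_le hcont hT
  have hae : ∀ ℓ : ℝ, 1 ≤ ℓ → ∀ᵐ x, -ℓ ≤ u x 0 ∧ u x 0 ≤ max L 1 := fun ℓ hℓ => by
    filter_upwards [hu.initial] with x hx
    have h1 := abs_le.1 (h₀ x)
    rw [hx]
    exact ⟨by linarith, h1.2.trans (le_max_right _ _)⟩
  -- Only the crude two-sided bound is available here, so the truncation level is the large `max L
  -- 1` instead of `1`.
  have hlow := (isBarrier_neg_one (n := n) ε (ℓ := max L 1) (L := max L 1) (T := T)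
    (by linarith [le_max_right L 1])).le_solution hε hu hcont
    (fun x t ht => abs_le.1 ((hL x t ht).trans (le_max_left _ _)))
    (hae _ (le_max_right _ _)) ((hae 1 le_rfl).mono fun x hx => hx.1)
  exact ⟨max L 1, le_max_right _ _, fun x t ht => ⟨hlow x t ht,
    (le_abs_self _).trans ((hL x t ht).trans (le_max_left _ _))⟩, hae 1 le_rfl⟩

/-- A barrier with values at most `1` that is at most `-1` off the ball on which the initial datum
equals `1` lies below the solution. -/
theorem IsSolution.barrier_le (hε : 0 < ε) (hu : IsSolution ε u₀ u)
    (hcont : ContinuousOn (fun p : EuclideanSpace ℝ (Fin (n + 1)) × ℝ => u p.1 p.2)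
      (univ ×ˢ Ioi 0)) (h₀ : ∀ x, |u₀ x| ≤ 1) {x₀ : EuclideanSpace ℝ (Fin (n + 1))} {R T : ℝ}
    (hball : ∀ x, ‖x - x₀‖ < R → u₀ x = 1) (hT : 0 < T)
    {w : EuclideanSpace ℝ (Fin (n + 1)) → ℝ → ℝ}
    (hw : ∀ L, 1 ≤ L → (∀ x, ∀ t ∈ Icc 0 T, R ≤ ‖x - x₀‖ → w x t ≤ -1) ∧ IsBarrier ε 1 L T w) :
    w x₀ T ≤ u x₀ T := by
  obtain ⟨L, hL, hub, hub₀⟩ := hu.exists_bounds hε hcont h₀ hT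
  refine (hw L hL).2.le_solution hε hu hcont hub hub₀ ?_ x₀ T ⟨hT, le_rfl⟩
  filter_upwards [hu.initial] with x hx
  rw [hx]
  rcases lt_or_ge ‖x - x₀‖ R with h | h
  · rw [hball x h]
    exact (hw 1 le_rfl).2.le x 0 ⟨le_rfl, hT.le⟩
  · exact ((hw 1 le_rfl).1 x 0 ⟨le_rfl, hT.le⟩ h).trans (abs_le.1 (h₀ x)).1

/-- For `b ≥ 0` the gap `1 - tanh b = 2/(1 + exp(2b))` is at least `exp(-2b)`, and `2 exp(-1) ≤ 1`.
-/
theorem tanh_le_of_exp_le {b E : ℝ} (hb : 0 ≤ b) (hE : E ≤ -1 - 2 * b) :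
    Real.tanh b ≤ 1 - 2 * Real.exp E := by
  rw [tanh_eq_one_sub]
  have h1 : Real.exp E ≤ Real.exp (-1) * (Real.exp (2 * b))⁻¹ := by
    rw [← Real.exp_neg, ← Real.exp_add]
    exact Real.exp_le_exp.2 (by linarith)
  have h2 : Real.exp (-1) ≤ 1 / 2 := by
    have := Real.exp_neg_one_lt_d9
    linarith
  have h3 : 1 ≤ Real.exp (2 * b) := Real.one_le_exp (by linarith)
  set P := Real.exp (2 * b)
  have h4 : Real.exp (-1) * P⁻¹ ≤ 1 / (1 + P) := by
    rw [← div_eq_mul_inv, div_le_div_iff₀ (by positivity) (by positivity)]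
    nlinarith
  rw [show 2 / (1 + P) = 2 * (1 / (1 + P)) by ring]
  linarith

/-- An extra `1/2` in the argument multiplies `exp(2b)` by `e ≥ 2`. The resulting gain in `tanh` is
of order `exp(-2b)` and outweighs a loss that carries the additional factor `exp(-15)`. -/
theorem tanh_le_tanh_sub {b y X : ℝ} (hb : 0 ≤ b) (hy : b + 1 / 2 ≤ y) (hX : 10 + 2 * b ≤ X) :
    Real.tanh b ≤ Real.tanh y - 2 * Real.exp (-(3 * X / 2)) := by
  rw [tanh_eq_one_sub, tanh_eq_one_sub]
  have hP : 1 ≤ Real.exp (2 * b) := Real.one_le_exp (by linarith)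
  have hQ : 2 * Real.exp (2 * b) ≤ Real.exp (2 * y) := by
    have h1 : Real.exp (2 * b) * Real.exp 1 ≤ Real.exp (2 * y) := by
      rw [← Real.exp_add]
      exact Real.exp_le_exp.2 (by linarith)
    have h2 : (2 : ℝ) ≤ Real.exp 1 := by
      have := Real.add_one_le_exp (1 : ℝ)
      linarith
    nlinarith
  have hE : Real.exp (-(3 * X / 2)) ≤ Real.exp (-15) * (Real.exp (2 * b))⁻¹ := by
    rw [← Real.exp_neg, ← Real.exp_add]
    exact Real.exp_le_exp.2 (by linarith)
  have h15 : Real.exp (-15) ≤ 1 / 16 := by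
    rw [Real.exp_neg, ← one_div]
    refine one_div_le_one_div_of_le (by norm_num) ?_
    have := Real.add_one_le_exp (15 : ℝ)
    linarith
  set P := Real.exp (2 * b)
  set Q := Real.exp (2 * y)
  have h1 : 2 / (1 + Q) ≤ 2 / (1 + 2 * P) := by gcongr
  have h2 : Real.exp (-15) * P⁻¹ ≤ 1 / 16 * P⁻¹ :=
    mul_le_mul_of_nonneg_right h15 (by positivity)
  have h3 : 2 / (1 + 2 * P) + 2 * (1 / 16 * P⁻¹) ≤ 2 / (1 + P) := by
    have e : 2 / (1 + P) - (2 / (1 + 2 * P) + 2 * (1 / 16 * P⁻¹)) =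
        (14 * P ^ 2 - 3 * P - 1) / (8 * P * (1 + P) * (1 + 2 * P)) := by
      have : P ≠ 0 := by positivity
      field_simp
      ring
    have : 0 ≤ (14 * P ^ 2 - 3 * P - 1) / (8 * P * (1 + P) * (1 + 2 * P)) :=
      div_nonneg (by nlinarith) (by positivity)
    linarith
  linarith

/-- The lower bound for times at most of order `ε²`. -/
theorem IsSolution.tanh_le_of_small_time (hε : 0 < ε) (hu : IsSolution ε u₀ u)
    (hcont : ContinuousOn (fun p : EuclideanSpace ℝ (Fin (n + 1)) × ℝ => u p.1 p.2)
      (univ ×ˢ Ioi 0)) (h₀ : ∀ x, |u₀ x| ≤ 1) {x₀ : EuclideanSpace ℝ (Fin (n + 1))}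
    {R T S b C : ℝ} (hball : ∀ x, ‖x - x₀‖ < R → u₀ x = 1) (hS1 : 1 ≤ S) (hS2 : S ^ 2 = n + 1)
    (hb : 0 ≤ b) (hC : 0 < C) (hR : R = (5 * S + b) * (C * ε)) (hT : T = (C * ε) ^ 2)
    (hcase : C ^ 2 ≤ 4 * ((n : ℝ) + 1) + 2 / 5 * b ^ 2) : Real.tanh b ≤ u x₀ T := by
  have hT0 : 0 < T := by rw [hT]; positivity
  have hR0 : 0 < R := by rw [hR]; positivity
  have h1 := hu.barrier_le hε hcont h₀ hball hT0
    (w := fun x t => 1 - 2 * Real.exp (t / (2 * ε ^ 2) +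
      ‖x - x₀‖ ^ 2 / (4 * (5 / 4 * T - t)) - R ^ 2 / (5 * T) + 2 * (n + 1) * t / T))
    fun L hL => isBarrier_gaussian hε hR0 hT0 hL x₀
  refine le_trans (tanh_le_of_exp_le hb ?_) h1
  rw [sub_self, norm_zero]
  have e1 : T / (2 * ε ^ 2) = C ^ 2 / 2 := by rw [hT]; field_simp
  have e2 : R ^ 2 / (5 * T) = (5 * S + b) ^ 2 / 5 := by rw [hT, hR]; field_simp
  have e3 : 2 * ((n : ℝ) + 1) * T / T = 2 * (n + 1) := by field_simp
  rw [e1, e2, e3, zero_pow two_ne_zero, zero_div, ← hS2]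
  rw [← hS2] at hcase
  -- The exponent is at most `-S² - 2Sb ≤ -1 - 2b`: the threshold in `hcase` is such that its `b²/5`
  -- cancels the one from `R²/(5T)`, and the multiples of `S²` add up to `2 - 5 + 2 = -1`.
  nlinarith

/-- The lower bound for times at least of order `ε²`. -/
theorem IsSolution.tanh_le_of_large_time (hε : 0 < ε) (hu : IsSolution ε u₀ u)
    (hcont : ContinuousOn (fun p : EuclideanSpace ℝ (Fin (n + 1)) × ℝ => u p.1 p.2)
      (univ ×ˢ Ioi 0)) (h₀ : ∀ x, |u₀ x| ≤ 1) {x₀ : EuclideanSpace ℝ (Fin (n + 1))}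
    {R T S b C : ℝ} (hball : ∀ x, ‖x - x₀‖ < R → u₀ x = 1) (hS1 : 1 ≤ S) (hS2 : S ^ 2 = n + 1)
    (hb : 0 ≤ b) (hC : 0 < C) (hR : R = (5 * S + b) * (C * ε)) (hT : T = (C * ε) ^ 2)
    (hcase : 4 * ((n : ℝ) + 1) + 2 / 5 * b ^ 2 ≤ C ^ 2) : Real.tanh b ≤ u x₀ T := by
  have hT0 : 0 < T := by rw [hT]; positivity
  have hR0 : 0 < R := by rw [hR]; positivity
  have hSb : b ≤ S * b := le_mul_of_one_le_left hb hS1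
  have hn : (1 : ℝ) ≤ n + 1 := by rw [← hS2]; exact one_le_pow₀ hS1
  have hC2 : 2 ≤ C := by
    refine le_of_sq_le_sq ?_ hC.le
    linarith [sq_nonneg b]
  obtain ⟨X, hX⟩ : ∃ X, X = (5 * S + b) * C := ⟨_, rfl⟩
  have hRX : R = X * ε := by rw [hR, hX]; ring
  have hX1 : 10 + 2 * b ≤ X := by
    rw [hX, show 10 + 2 * b = (5 * 1 + b) * 2 by ring]
    gcongr
  -- The second-order Taylor bound for `exp(3X/2)` with `X ≥ 10` gives more than `11X`, which covers
  -- both smallness conditions on `δ`.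
  have hexpX : Real.exp (-(3 * X / 2)) * (11 * X) ≤ 1 := by
    have h1 := Real.quadratic_le_exp_of_nonneg (x := 3 * X / 2) (by linarith)
    have h2 : 10 * X ≤ X ^ 2 := by nlinarith
    rw [Real.exp_neg, inv_mul_le_iff₀ (Real.exp_pos _)]
    linarith
  have hexp : Real.exp (-(3 * R / (2 * ε))) = Real.exp (-(3 * X / 2)) := by
    congr 2
    rw [hRX]
    field_simp
  have hE0 := Real.exp_pos (-(3 * X / 2))
  have hδ : 2 * Real.exp (-(3 * R / (2 * ε))) ≤ 2 / 3 := by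
    rw [hexp]; nlinarith
  have hδR : 4 * R * (2 * Real.exp (-(3 * R / (2 * ε)))) ≤ ((n : ℝ) + 1) * ε := by
    have h1 : 8 * X * Real.exp (-(3 * X / 2)) ≤ n + 1 := by nlinarith
    have h2 := mul_le_mul_of_nonneg_right h1 hε.le
    rw [hexp, hRX]
    linarith
  -- The constant `5` in the theorem leaves `25/4 - 6 = 1/4` here, so the sphere still has positive
  -- radius at time `T`.
  have hD : R ^ 2 / 4 - 6 * ((n : ℝ) + 1) * T =
      (C * ε) ^ 2 * ((n + 1) / 4 + 5 / 2 * (S * b) + b ^ 2 / 4) := by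
    rw [hR, hT, ← hS2]; ring
  have hDpos : 0 < R ^ 2 / 4 - 6 * ((n : ℝ) + 1) * T := by rw [hD]; positivity
  have h1 := hu.barrier_le hε hcont h₀ hball hT0
    (w := fun x t => Real.tanh ((R ^ 2 / 4 - 6 * (n + 1) * t - ‖x - x₀‖ ^ 2) /
      (2 * √(R ^ 2 / 4 - 6 * (n + 1) * t) * ε)) - 2 * Real.exp (-(3 * R / (2 * ε))))
    fun L hL => isBarrier_sphere hε hR0 (by linarith) rfl hδ hδR hL x₀
  refine le_trans ?_ h1
  rw [hexp, sub_self, norm_zero]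
  refine tanh_le_tanh_sub hb ?_ hX1
  have hr2 := Real.sq_sqrt hDpos.le
  have hr0 := Real.sqrt_pos.2 hDpos
  generalize √(R ^ 2 / 4 - 6 * (n + 1) * T) = r at hr2 hr0 ⊢
  rw [zero_pow two_ne_zero, sub_zero, ← hr2]
  have e : r ^ 2 / (2 * r * ε) = r / (2 * ε) := by field_simp
  rw [e]
  refine le_of_sq_le_sq ?_ (by positivity)
  have e2 : (r / (2 * ε)) ^ 2 =
      C ^ 2 * (((n : ℝ) + 1) / 4 + 5 / 2 * (S * b) + b ^ 2 / 4) / 4 := by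
    rw [div_pow, hr2, hD]
    field_simp
    ring
  rw [e2]
  have hA : 1 / 4 + 5 / 2 * b + b ^ 2 / 4 ≤ ((n : ℝ) + 1) / 4 + 5 / 2 * (S * b) + b ^ 2 / 4 := by
    linarith
  have hB : 4 + 2 / 5 * b ^ 2 ≤ C ^ 2 := by linarith
  have hAB := mul_le_mul hB hA (by positivity) (by positivity)
  -- With equality at `b = 0`: the lower bound on `C²` is just enough to gain the `1/2` that offsets
  -- `δ`.
  have hpoly : (b + 1 / 2) ^ 2 ≤ (4 + 2 / 5 * b ^ 2) * (1 / 4 + 5 / 2 * b + b ^ 2 / 4) / 4 := by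
    have e3 : (4 + 2 / 5 * b ^ 2) * (1 / 4 + 5 / 2 * b + b ^ 2 / 4) / 4 - (b + 1 / 2) ^ 2 =
        b * (1 / 4 * (b - 3 / 2) ^ 2 + 1 / 40 * b + 15 / 16) + 1 / 40 * b ^ 4 := by ring
    have : 0 ≤ b * (1 / 4 * (b - 3 / 2) ^ 2 + 1 / 40 * b + 15 / 16) + 1 / 40 * b ^ 4 := by
      positivity
    linarith
  linarith

/-- Lower bound for a solution whose initial datum equals `1` on a ball that is large compared
with `√t`. -/
theorem IsSolution.tanh_le (hε : 0 < ε) (hu : IsSolution ε u₀ u)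
    (hcont : ContinuousOn (fun p : EuclideanSpace ℝ (Fin (n + 1)) × ℝ => u p.1 p.2)
      (univ ×ˢ Ioi 0)) (h₀ : ∀ x, |u₀ x| ≤ 1) {x₀ : EuclideanSpace ℝ (Fin (n + 1))} {R T : ℝ}
    (hball : ∀ x, ‖x - x₀‖ < R → u₀ x = 1) (hT : 0 < T)
    (hR : 5 * √((n : ℝ) + 1) * √T ≤ R) :
    Real.tanh (R / √T - 5 * √((n : ℝ) + 1)) ≤ u x₀ T := by
  have hn : (1 : ℝ) ≤ n + 1 := by simp
  have hS2 : √((n : ℝ) + 1) ^ 2 = n + 1 := Real.sq_sqrt (by linarith)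
  have hS1 : 1 ≤ √((n : ℝ) + 1) := Real.one_le_sqrt.2 hn
  have hθ : 0 < √T := Real.sqrt_pos.2 hT
  have hb : 0 ≤ R / √T - 5 * √((n : ℝ) + 1) := by
    rw [sub_nonneg, le_div_iff₀ hθ]
    exact hR
  have hC : 0 < √T / ε := by positivity
  have hθC : √T / ε * ε = √T := by field_simp
  have hR' : R = (5 * √((n : ℝ) + 1) + (R / √T - 5 * √((n : ℝ) + 1))) * (√T / ε * ε) := by
    rw [hθC]; field_simp; ring
  have hT' : T = (√T / ε * ε) ^ 2 := by rw [hθC, Real.sq_sqrt hT.le]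
  -- At the threshold `4(n + 1) + (2/5)b²` for `T/ε²` both barriers are effective, so the two cases
  -- cover all times.
  rcases le_total ((√T / ε) ^ 2)
    (4 * ((n : ℝ) + 1) + 2 / 5 * (R / √T - 5 * √((n : ℝ) + 1)) ^ 2) with hcase | hcase
  · exact hu.tanh_le_of_small_time hε hcont h₀ hball hS1 hS2 hb hC hR' hT' hcase
  · exact hu.tanh_le_of_large_time hε hcont h₀ hball hS1 hS2 hb hC hR' hT' hcase

/-! ### The initial datum near a point off the boundary -/

section geometry

variable {Ω : Set (EuclideanSpace ℝ (Fin (n + 1)))} {x : EuclideanSpace ℝ (Fin (n + 1))}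

theorem abs_initialDatum_le (Ω : Set (EuclideanSpace ℝ (Fin (n + 1))))
    (x : EuclideanSpace ℝ (Fin (n + 1))) : |initialDatum Ω x| ≤ 1 := by
  unfold initialDatum
  by_cases h : x ∈ closure Ω
  · rw [indicator_of_mem h]; norm_num
  · rw [indicator_of_notMem h]; norm_num

/-- A ball that misses the frontier of `Ω` and meets `Ω` lies in `Ω`. -/
theorem ball_subset_of_mem {r : ℝ} (hr : Disjoint (Metric.ball x r) (frontier Ω))
    {y z : EuclideanSpace ℝ (Fin (n + 1))} (hy : y ∈ Metric.ball x r) (hyΩ : y ∈ Ω)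
    (hz : z ∈ Metric.ball x r) : z ∈ Ω := by
  by_contra hzΩ
  have hpre : IsPreconnected (Metric.ball x r) := (convex_ball x r).isPreconnected
  -- Off the frontier, interior and exterior are disjoint open sets covering the connected ball, so
  -- only one of them can meet it.
  have hsub : Metric.ball x r ⊆ interior Ω ∪ (closure Ω)ᶜ := by
    intro p hp
    by_cases h : p ∈ closure Ω
    · refine Or.inl (by_contra fun h' => disjoint_left.1 hr hp ⟨h, h'⟩)
    · exact Or.inr h
  have h1 : (Metric.ball x r ∩ interior Ω).Nonempty :=
    ⟨y, hy, (hsub hy).resolve_right fun h => h (subset_closure hyΩ)⟩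
  have h2 : (Metric.ball x r ∩ (closure Ω)ᶜ).Nonempty :=
    ⟨z, hz, (hsub hz).resolve_left fun h => hzΩ (interior_subset h)⟩
  obtain ⟨p, -, hp1, hp2⟩ := hpre _ _ isOpen_interior isClosed_closure.isOpen_compl hsub h1 h2
  exact hp2 (interior_subset_closure hp1)

theorem initialDatum_eq_one (hx : x ∈ Ω) {y : EuclideanSpace ℝ (Fin (n + 1))}
    (hy : ‖y - x‖ < Metric.infDist x (frontier Ω)) : initialDatum Ω y = 1 := by
  have hr : 0 < Metric.infDist x (frontier Ω) := (norm_nonneg _).trans_lt hy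
  have := ball_subset_of_mem Metric.disjoint_ball_infDist (Metric.mem_ball_self hr) hx
    (by simpa [dist_eq_norm] using hy)
  unfold initialDatum
  rw [indicator_of_mem (subset_closure this)]
  norm_num

theorem initialDatum_eq_neg_one (hx : x ∉ Ω) {y : EuclideanSpace ℝ (Fin (n + 1))}
    (hy : ‖y - x‖ < Metric.infDist x (frontier Ω)) : initialDatum Ω y = -1 := by
  have hr : 0 < Metric.infDist x (frontier Ω) := (norm_nonneg _).trans_lt hy
  have hyb : y ∈ Metric.ball x (Metric.infDist x (frontier Ω)) := by
    simpa [dist_eq_norm] using hy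
  have : y ∉ closure Ω := by
    intro hcl
    obtain ⟨z, hz, hzΩ⟩ := mem_closure_iff.1 hcl _ Metric.isOpen_ball hyb
    exact hx (ball_subset_of_mem Metric.disjoint_ball_infDist hz hzΩ (Metric.mem_ball_self hr))
  unfold initialDatum
  rw [indicator_of_notMem this]
  norm_num

end geometry

end AllenCahn

theorem mainTheorem10 (n : ℕ) (Ω : Set (EuclideanSpace ℝ (Fin (n + 1))))
    (hΩ : AllenCahn.BoundsGeneralisedHypersurface n Ω)
    (ε : ℝ) (hε : 0 < ε)
    (u : EuclideanSpace ℝ (Fin (n + 1)) → ℝ → ℝ)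
    (hu : AllenCahn.IsSolution ε (AllenCahn.initialDatum Ω) u)
    (hcont : ContinuousOn (fun p : EuclideanSpace ℝ (Fin (n + 1)) × ℝ => u p.1 p.2)
      (Set.univ ×ˢ Set.Ioi 0)) :
    ∀ (x : EuclideanSpace ℝ (Fin (n + 1))) (t : ℝ), 0 < t →
      (5 * √((n : ℝ) + 1) * √t ≤ AllenCahn.signedDist Ω x →
        Real.tanh (AllenCahn.signedDist Ω x / √t - 5 * √((n : ℝ) + 1)) ≤ u x t) ∧
      (AllenCahn.signedDist Ω x ≤ -(5 * √((n : ℝ) + 1) * √t) →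
        u x t ≤ Real.tanh (AllenCahn.signedDist Ω x / √t + 5 * √((n : ℝ) + 1))) := by
  intro x t ht
  have hpos : 0 < 5 * √((n : ℝ) + 1) * √t := by positivity
  have h₀ := AllenCahn.abs_initialDatum_le Ω
  by_cases hx : x ∈ Ω
  · have hd : AllenCahn.signedDist Ω x = Metric.infDist x (frontier Ω) := if_pos hx
    rw [hd]
    refine ⟨fun h => hu.tanh_le hε hcont h₀ (fun y hy => AllenCahn.initialDatum_eq_one hx hy) ht h,
      fun h => ?_⟩
    have := Metric.infDist_nonneg (x := x) (s := frontier Ω)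
    linarith
  · have hd : AllenCahn.signedDist Ω x = -Metric.infDist x (frontier Ω) := if_neg hx
    rw [hd]
    refine ⟨fun h => ?_, fun h => ?_⟩
    · have := Metric.infDist_nonneg (x := x) (s := frontier Ω)
      linarith
    -- Outside `Ω` the negated datum equals `1` on the ball reaching to the boundary, so the lower
    -- bound applies to `-u`.
    · have h1 := hu.neg.tanh_le hε hcont.neg (x₀ := x) (R := Metric.infDist x (frontier Ω))
        (fun y => by rw [abs_neg]; exact h₀ y)
        (fun y hy => by rw [AllenCahn.initialDatum_eq_neg_one hx hy, neg_neg]) ht (by linarith)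
      rw [show -Metric.infDist x (frontier Ω) / √t + 5 * √((n : ℝ) + 1) =
        -(Metric.infDist x (frontier Ω) / √t - 5 * √((n : ℝ) + 1)) by ring, Real.tanh_neg]
      linarith
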